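/- Setting. Let $n,m\in\mathbb N$, let $f=(f_1,\dots,f_n)$ with $f_i\in\mathbb R[\mathbf x]=\mathbb R[x_1,\dots,x_n]$, and consider either the discrete-time system $\mathbf x_{t+1}=f(\mathbf x_t)$ or the continuous-time system $\dot{\mathbf x}=f(\mathbf x)$. Let $\mathbf X=\{\mathbf x\in\mathbb R^n: g_1(\mathbf x)\ge 0,\dots,g_m(\mathbf x)\ge 0\}$ with $g_j\in\mathbb R[\mathbf x]$, where one of the $g_j$ equals $N-\|\mathbf x\|_2^2$ for some integer $N$. Let $\lambda$ be the restriction of Lebesgue measure to $\mathbf X$ and $z_\alpha=\int \mathbf x^\alpha\,d\lambda$. For $1\le s\le\infty$ write $\mu\in L^s_+(\mathbf X)$ if $\mu$ is a finite nonnegative Borel measure with $\mu\ll\lambda$ whose density $h$ is in $L^s(\lambda)$, and put $\|\mu\|_s:=\|h\|_{L^s(\lambda)}$. A finite measure $\mu$ is invariant, $\mathcal L(\mu)=0$, if $f_\#\mu=\mu$ (discrete time), respectively if $\int \mathrm{grad}\,v\cdot f\,d\mu=0$ for all $v\in\mathcal C^1$ (continuous time). Conic problem. For $p\in\{2,\infty\}$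 let $$\rho^\star_{\rm ac}:=\sup\Big\{\int_{\mathbf X}\mu \;:\; \mathcal L(\mu)=0,\ \|\mu\|_p\le 1,\ \mu\in L^p_+(\mathbf X)\Big\}.$$ SDP hierarchy. For a real sequence $\mathbf y=(y_\alpha)_{\alpha\in\mathbb N^n}$ let $\ell_{\mathbf y}(\sum_\beta c_\beta \mathbf x^\beta)=\sum_\beta c_\beta y_\beta$, and let $\mathscr I_{\mathbf y}(q)=\ell_{\mathbf y}(q\circ f)-\ell_{\mathbf y}(q)$ (discrete time), respectively $\mathscr I_{\mathbf y}(q)=\ell_{\mathbf y}(\mathrm{grad}\,q\cdot f)$ (continuous time). Let $g_0=1$, $r_j=\lceil \deg g_j/2\rceil$, $r_{\min}=\max\{1,r_1,\dots,r_m\}$. For $0\le j\le m$ let $\mathbf M_{r-r_j}(g_j\mathbf y)$ be the matrix $\big(\ell_{\mathbf y}(g_j\mathbf x^{\beta+\gamma})\big)_{|\beta|,|\gamma|\le r-r_j}$, with $\mathbf M_r(\mathbf y):=\mathbf M_r(g_0\mathbf y)$. Let $\mathbf v_r(\mathbf y)=(y_\alpha)_{|\alpha|\le r}$ and $$\mathbf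 C^2_r(\mathbf y)=\begin{pmatrix}\mathbf M_r(\mathbf z)&\mathbf v_r(\mathbf y)\\ \mathbf v_r(\mathbf y)^T&1\end{pmatrix},\qquad \mathbf C^\infty_r(\mathbf y)=\mathbf M_r(\mathbf z)-\mathbf M_r(\mathbf y).$$ For $r\ge r_{\min}$ let $\rho^r_{\rm ac}$ be the supremum of $y_0$ subject to $$\mathscr I_{\mathbf y}(\mathbf x^\alpha)=0\ \ (|\alpha|\le 2r),\qquad \mathbf C^p_r(\mathbf y)\succeq0,\qquad \mathbf M_{r-r_j}(g_j\mathbf y)\succeq 0\ \ (j=0,\dots,m),$$ over vectors $\mathbf y=(y_\alpha)_{|\alpha|\le D_r}$ with $D_r=2r\max\{1,\deg f_1,\dots,\deg f_n\}$, which contain all the moments that occur in the constraints. Statement. Let $p=2$ or $p=\infty$, and assume that there is exactly one invariant probability measure in $L^p_+(\mathbf X)$. Then the conic problem has a unique optimal solution $\mu^\star_{\rm ac}$, and the SDP of order $r$ has an optimal solution for every $r\ge r_{\min}$. If $\mathbf y^r$ is an arbitrary optimal solution of the SDP of order $r$ for each $r\ge r_{\min}$, completed by zeros to a sequence indexed by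 $\mathbb N^n$, then there is a sequence $\mathbf y^\star=(y^\star_\alpha)_{\alpha\in\mathbb N^n}$ such that $$\lim_{r\to\infty}y^r_\alpha=y^\star_\alpha\qquad\text{for every fixed }\alpha\in\mathbb N^n ,$$ and $\mu^\star_{\rm ac}$ is a representing measure of $\mathbf y^\star$ on $\mathbf X$, that is, $y^\star_\alpha=\int\mathbf x^\alpha\,d\mu^\star_{\rm ac}$ for all $\alpha$. Moreover $$\lim_{r\to\infty}\rho^r_{\rm ac}=\rho^\star_{\rm ac}=\|\mu^\star_{\rm ac}\|_1 .$$ -/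

import Mathlib

open MeasureTheory Filter Topology
open scoped ENNReal

namespace InvMeas

noncomputable section

/-- The two kinds of polynomial dynamics: `x_{t+1} = f (x_t)` and `x' = f x`. -/
inductive TimeKind where
  | discrete
  | continuous

/-- The polynomial map `f : ℝⁿ → ℝⁿ` with components `f i`. -/
def polyMap {n : ℕ} (f : Fin n → MvPolynomial (Fin n) ℝ) (x : Fin n → ℝ) : Fin n → ℝ :=
  fun i => MvPolynomial.eval x (f i)

/-- The degree of the map `f`, the maximum of the degrees of its components. -/
def mapDegree {n : ℕ} (f : Fin n → MvPolynomial (Fin n) ℝ) : ℕ :=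
  Finset.univ.sup fun i => (f i).totalDegree

/-- The basic semialgebraic set `{x | g₁ x ≥ 0, …, g_m x ≥ 0}`. -/
def semialgSet {n m : ℕ} (g : Fin m → MvPolynomial (Fin n) ℝ) : Set (Fin n → ℝ) :=
  {x | ∀ j, 0 ≤ MvPolynomial.eval x (g j)}

/-- One of the polynomials `g j` is `N - ‖x‖₂²` for an integer `N`. -/
def Archimedean {n m : ℕ} (g : Fin m → MvPolynomial (Fin n) ℝ) : Prop :=
  ∃ (j : Fin m) (N : ℤ),
    g j = MvPolynomial.C (N : ℝ) - ∑ i : Fin n, (MvPolynomial.X i : MvPolynomial (Fin n) ℝ) ^ 2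

/-! ### Measures on `X`, their densities, invariance -/

/-- The restriction `λ_X` of the Lebesgue measure to `X`. -/
def leb {n : ℕ} (X : Set (Fin n → ℝ)) : Measure (Fin n → ℝ) :=
  (volume : Measure (Fin n → ℝ)).restrict X

/-- The density of `μ` with respect to `λ_X` (meaningful for finite `μ ≪ λ_X`). -/
def density {n : ℕ} (X : Set (Fin n → ℝ)) (μ : Measure (Fin n → ℝ)) (x : Fin n → ℝ) : ℝ :=
  (μ.rnDeriv (leb X) x).toReal

/-- `μ ∈ L^p_+(X)`: a finite nonnegative Borel measure on `X`, absolutely continuous with respect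
to `λ_X`, whose density lies in `L^p`. (Absolute continuity forces `μ Xᶜ = 0` for measurable
`X`.) -/
def InLp {n : ℕ} (X : Set (Fin n → ℝ)) (p : ℝ≥0∞) (μ : Measure (Fin n → ℝ)) : Prop :=
  IsFiniteMeasure μ ∧ μ ≪ leb X ∧ MemLp (density X μ) p (leb X)

/-- `‖μ‖_p`, the `L^p(λ_X)` norm of the density of `μ`. -/
def lpNorm {n : ℕ} (X : Set (Fin n → ℝ)) (p : ℝ≥0∞) (μ : Measure (Fin n → ℝ)) : ℝ≥0∞ :=
  eLpNorm (density X μ) p (leb X)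

/-- Invariance of a finite measure: `f_# μ = μ` in discrete time; `div (f μ) = 0`, tested against
all `C¹` functions, in continuous time. -/
def Invariant {n : ℕ} (k : TimeKind) (f : Fin n → MvPolynomial (Fin n) ℝ)
    (μ : Measure (Fin n → ℝ)) : Prop :=
  match k with
  | .discrete => μ.map (polyMap f) = μ
  | .continuous => ∀ v : (Fin n → ℝ) → ℝ, ContDiff ℝ 1 v →
      ∫ x, fderiv ℝ v x (polyMap f x) ∂μ = 0

/-- Existence and uniqueness of an invariant probability measure with density in `L^p(X)`. -/
def UniqueInvariantDensity {n : ℕ} (k : TimeKind) (f : Fin n → MvPolynomial (Fin n) ℝ)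
    (X : Set (Fin n → ℝ)) (p : ℝ≥0∞) : Prop :=
  ∃! μ : Measure (Fin n → ℝ), IsProbabilityMeasure μ ∧ InLp X p μ ∧ Invariant k f μ

/-! ### The infinite-dimensional conic problem -/

/-- Feasibility in: maximize `∫_X μ` subject to `L μ = 0`, `‖μ‖_p ≤ 1`, `μ ∈ L^p_+(X)`. -/
def ConicFeasible {n : ℕ} (k : TimeKind) (f : Fin n → MvPolynomial (Fin n) ℝ)
    (X : Set (Fin n → ℝ)) (p : ℝ≥0∞) (μ : Measure (Fin n → ℝ)) : Prop :=
  Invariant k f μ ∧ lpNorm X p μ ≤ 1 ∧ InLp X p μ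

/-- `μ` is an optimal solution of the conic problem. -/
def ConicOptimal {n : ℕ} (k : TimeKind) (f : Fin n → MvPolynomial (Fin n) ℝ)
    (X : Set (Fin n → ℝ)) (p : ℝ≥0∞) (μ : Measure (Fin n → ℝ)) : Prop :=
  ConicFeasible k f X p μ ∧ ∀ ν, ConicFeasible k f X p ν → ν.real X ≤ μ.real X

/-- The optimal value `ρ*` of the conic problem. -/
def conicValue {n : ℕ} (k : TimeKind) (f : Fin n → MvPolynomial (Fin n) ℝ)
    (X : Set (Fin n → ℝ)) (p : ℝ≥0∞) : ℝ :=
  sSup {t : ℝ | ∃ μ, ConicFeasible k f X p μ ∧ t = μ.real X}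

/-! ### Moments, moment matrices and localizing matrices -/

/-- The exponents `α ∈ ℕⁿ` with `|α| ≤ r`. -/
abbrev Expo (n r : ℕ) : Type := {α : Fin n →₀ ℕ // α.degree ≤ r}

/-- The moment `∫ x^α dμ`. -/
def moment {n : ℕ} (μ : Measure (Fin n → ℝ)) (α : Fin n →₀ ℕ) : ℝ :=
  ∫ x, ∏ i, x i ^ α i ∂μ

/-- `μ` is a finite nonnegative measure on `X` representing the sequence `y`. -/
def Represents {n : ℕ} (X : Set (Fin n → ℝ)) (y : (Fin n →₀ ℕ) → ℝ)
    (μ : Measure (Fin n → ℝ)) : Prop :=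
  IsFiniteMeasure μ ∧ μ Xᶜ = 0 ∧ ∀ α, y α = moment μ α

/-- The linear functional `ℓ_y(p) = ∑_β p_β y_β`. -/
def riesz {n : ℕ} (y : (Fin n →₀ ℕ) → ℝ) (p : MvPolynomial (Fin n) ℝ) : ℝ :=
  ∑ β ∈ p.support, p.coeff β * y β

/-- The matrix with entries `ℓ_y(g x^(β+γ))`, for `|β|, |γ| ≤ s`. -/
def locMatrix {n : ℕ} (s : ℕ) (g : MvPolynomial (Fin n) ℝ) (y : (Fin n →₀ ℕ) → ℝ) :
    Matrix (Expo n s) (Expo n s) ℝ :=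
  fun β γ => riesz y (g * MvPolynomial.monomial (β.1 + γ.1) 1)

/-- The moment matrix `M_r(y)`. -/
def momMatrix {n : ℕ} (r : ℕ) (y : (Fin n →₀ ℕ) → ℝ) : Matrix (Expo n r) (Expo n r) ℝ :=
  locMatrix r 1 y

/-- `r_j = ⌈deg g_j / 2⌉`. -/
def halfDeg {n : ℕ} (g : MvPolynomial (Fin n) ℝ) : ℕ := (g.totalDegree + 1) / 2

/-- `r_min = max {1, r_1, …, r_m}`. -/
def rMin {n m : ℕ} (g : Fin m → MvPolynomial (Fin n) ℝ) : ℕ :=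
  max 1 (Finset.univ.sup fun j => halfDeg (g j))

/-- The functional `p ↦ ℓ_y(p ∘ f) - ℓ_y(p)` in discrete time, and `p ↦ ℓ_y(grad p · f)` in
continuous time. -/
def invFunctional {n : ℕ} (k : TimeKind) (f : Fin n → MvPolynomial (Fin n) ℝ)
    (y : (Fin n →₀ ℕ) → ℝ) (p : MvPolynomial (Fin n) ℝ) : ℝ :=
  match k with
  | .discrete => riesz y (MvPolynomial.bind₁ f p) - riesz y p
  | .continuous => riesz y (∑ i, MvPolynomial.pderiv i p * f i)

/-- `C²_r(y)`: the matrix with blocks `M_r(z)`, the vector `(y_α)_{|α| ≤ r}`, its transpose, and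
`1`, where `z` is the moment sequence of `λ_X`. -/
def cTwo {n : ℕ} (X : Set (Fin n → ℝ)) (r : ℕ) (y : (Fin n →₀ ℕ) → ℝ) :
    Matrix (Expo n r ⊕ Unit) (Expo n r ⊕ Unit) ℝ :=
  Matrix.fromBlocks (momMatrix r (moment (leb X))) (fun α _ => y α.1) (fun _ α => y α.1) 1

/-- `C^∞_r(y) = M_r(z) - M_r(y)`. -/
def cInf {n : ℕ} (X : Set (Fin n → ℝ)) (r : ℕ) (y : (Fin n →₀ ℕ) → ℝ) :
    Matrix (Expo n r) (Expo n r) ℝ :=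
  momMatrix r (moment (leb X)) - momMatrix r y

/-! ### The hierarchy of semidefinite programs -/

/-- All the entries of `y` that occur in the constraints of order `r` (including those of
`ℓ_y(f^α)` with `|α| ≤ 2 r`) have degree at most `2 r · max (1, deg f)`. -/
def sdpDegree {n : ℕ} (f : Fin n → MvPolynomial (Fin n) ℝ) (r : ℕ) : ℕ :=
  2 * r * max 1 (mapDegree f)

/-- Completion of a finite vector by zeros to a sequence indexed by `ℕⁿ`. -/
def zeroExt {n d : ℕ} (y : Expo n d → ℝ) (α : Fin n →₀ ℕ) : ℝ :=
  if h : α.degree ≤ d then y ⟨α, h⟩ else 0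

/-- Feasibility of the finite vector `y` for the semidefinite program of order `r`
(for `p = 2` or `p = ∞`). -/
def SdpFeasible {n m : ℕ} (k : TimeKind) (f : Fin n → MvPolynomial (Fin n) ℝ)
    (g : Fin m → MvPolynomial (Fin n) ℝ) (p : ℝ≥0∞) (r : ℕ)
    (y : Expo n (sdpDegree f r) → ℝ) : Prop :=
  (∀ α : Fin n →₀ ℕ, α.degree ≤ 2 * r →
    invFunctional k f (zeroExt y) (MvPolynomial.monomial α 1) = 0) ∧
  (p = 2 → (cTwo (semialgSet g) r (zeroExt y)).PosSemidef) ∧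
  (p = ∞ → (cInf (semialgSet g) r (zeroExt y)).PosSemidef) ∧
  (momMatrix r (zeroExt y)).PosSemidef ∧
  ∀ j, (locMatrix (r - halfDeg (g j)) (g j) (zeroExt y)).PosSemidef

/-- `y` is an optimal solution of the semidefinite program of order `r`, whose objective is to
maximize `y_0`. -/
def SdpOptimal {n m : ℕ} (k : TimeKind) (f : Fin n → MvPolynomial (Fin n) ℝ)
    (g : Fin m → MvPolynomial (Fin n) ℝ) (p : ℝ≥0∞) (r : ℕ)
    (y : Expo n (sdpDegree f r) → ℝ) : Prop :=
  SdpFeasible k f g p r y ∧ ∀ w, SdpFeasible k f g p r w → zeroExt w 0 ≤ zeroExt y 0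

/-- The optimal value `ρ^r` of the semidefinite program of order `r`. -/
def sdpValue {n m : ℕ} (k : TimeKind) (f : Fin n → MvPolynomial (Fin n) ℝ)
    (g : Fin m → MvPolynomial (Fin n) ℝ) (p : ℝ≥0∞) (r : ℕ) : ℝ :=
  sSup {t : ℝ | ∃ y, SdpFeasible k f g p r y ∧ t = zeroExt y 0}

end

end InvMeas

/-!
# Convergence of the moment hierarchy for absolutely continuous invariant measures

Let `X` be the compact semialgebraic set, `λ` the Lebesgue measure on it with moment sequence `z`,
and `ℓ_y` the functional on polynomials attached to a sequence `y`.

*Conic problem.* An invariant measure with density in `L^p` is a multiple of the unique invariant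
probability measure `μ₀` of this kind (`eq_smul_of_invariant`). The measures feasible for the conic
problem are therefore the `b • μ₀` with `b ‖μ₀‖_p ≤ 1`, and the only optimal one has norm `1`
(`exists_unique_conicOptimal`).

*Semidefinite programs.* The matrix constraints are inequalities for `ℓ_y` on squares of polynomials
(`psdConstraints_iff`). The localizing constraint of `N - ‖x‖²` and the bound on `y₀` given by the
matrix `C^p_r(y)` bound all moments of order at most `2 r`, uniformly in `r`
(`PsdConstraints.abs_le`); this gives optimal solutions (`exists_sdpOptimal`) and, as `r → ∞`,
limit points.

*Limit points are moment sequences.* A limit `y` satisfies the constraints of all orders. Instead of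
a Positivstellensatz, the domination by Lebesgue moments is used: `ℓ_y(q)² ≤ C² ∫ q² dλ` for all
polynomials `q`, so that by the theorems of Hahn-Banach and Riesz `ℓ_y(q) = ∫ u q dλ` for some `u`
in `L²(λ)` (`exists_density_of_riesz_sq_le`). By the Weierstrass approximation theorem,
`ℓ_y(q²) ≥ 0` gives `u ≥ 0`, and, for `p = ∞`, `ℓ_y(q²) ≤ ℓ_z(q²)` gives `u ≤ 1`
(`ae_nonneg_of_polynomial`).

*Invariance.* The limit satisfies the invariance equations for polynomials only. In discrete time
these suffice because measures on compact sets are determined by their moments. In continuous time a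
`C¹` test function is cut off and convolved with Landau kernels, that is, powers of the polynomial
`A - ‖x‖²`. On `X` this convolution is a polynomial, and its gradients converge pointwise and
boundedly (`invariant_of_integral_invOp`).

*Conclusion.* Every limit point of the optimal solutions is thus the moment sequence of a measure
feasible for the conic problem, and its mass is at least the optimal value since truncated moment
sequences are feasible for the semidefinite programs. It is the optimal measure, so that all limit
points agree (`tendsto_sdpOptimal`).
-/

namespace InvMeas

noncomputable section

variable {n m : ℕ}

/-! ### The functional `ℓ_y` -/

theorem riesz_eq_sum_of_subset (y : (Fin n →₀ ℕ) → ℝ) {p : MvPolynomial (Fin n) ℝ}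
    {s : Finset (Fin n →₀ ℕ)} (h : p.support ⊆ s) : riesz y p = ∑ β ∈ s, p.coeff β * y β :=
  Finset.sum_subset h fun β _ hβ => by rw [MvPolynomial.notMem_support_iff.1 hβ, zero_mul]

/-- The functional `ℓ_y` as a linear map. -/
def rieszLin (y : (Fin n →₀ ℕ) → ℝ) : MvPolynomial (Fin n) ℝ →ₗ[ℝ] ℝ where
  toFun := riesz y
  map_add' p q := by
    classical
    rw [riesz_eq_sum_of_subset y (MvPolynomial.support_add (p := p) (q := q)),
      riesz_eq_sum_of_subset y (Finset.subset_union_left : p.support ⊆ p.support ∪ q.support),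
      riesz_eq_sum_of_subset y (Finset.subset_union_right : q.support ⊆ p.support ∪ q.support),
      ← Finset.sum_add_distrib]
    exact Finset.sum_congr rfl fun β _ => by rw [MvPolynomial.coeff_add, add_mul]
  map_smul' c p := by
    rw [riesz_eq_sum_of_subset y (MvPolynomial.support_smul (a := c) (f := p)), riesz,
      RingHom.id_apply, smul_eq_mul, Finset.mul_sum]
    exact Finset.sum_congr rfl fun β _ => by rw [MvPolynomial.coeff_smul, smul_eq_mul, mul_assoc]

@[simp] theorem rieszLin_apply (y : (Fin n →₀ ℕ) → ℝ) (p : MvPolynomial (Fin n) ℝ) :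
    rieszLin y p = riesz y p := rfl

theorem riesz_add (y : (Fin n →₀ ℕ) → ℝ) (p q : MvPolynomial (Fin n) ℝ) :
    riesz y (p + q) = riesz y p + riesz y q := map_add (rieszLin y) p q

theorem riesz_sub (y : (Fin n →₀ ℕ) → ℝ) (p q : MvPolynomial (Fin n) ℝ) :
    riesz y (p - q) = riesz y p - riesz y q := map_sub (rieszLin y) p q

theorem riesz_smul (y : (Fin n →₀ ℕ) → ℝ) (c : ℝ) (p : MvPolynomial (Fin n) ℝ) :
    riesz y (c • p) = c * riesz y p := map_smul (rieszLin y) c p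

theorem riesz_sum {ι : Type*} (y : (Fin n →₀ ℕ) → ℝ) (s : Finset ι)
    (p : ι → MvPolynomial (Fin n) ℝ) : riesz y (∑ i ∈ s, p i) = ∑ i ∈ s, riesz y (p i) :=
  map_sum (rieszLin y) p s

@[simp] theorem riesz_monomial (y : (Fin n →₀ ℕ) → ℝ) (α : Fin n →₀ ℕ) (c : ℝ) :
    riesz y (MvPolynomial.monomial α c) = c * y α := by
  classical
  rw [riesz_eq_sum_of_subset y (MvPolynomial.support_monomial_subset (s := α) (a := c))]
  simp

theorem degree_le_totalDegree {p : MvPolynomial (Fin n) ℝ} {α : Fin n →₀ ℕ}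
    (h : α ∈ p.support) : α.degree ≤ p.totalDegree := MvPolynomial.le_totalDegree h

/-- `ℓ_y(p)` depends only on the moments of order at most `deg p`. -/
theorem riesz_congr {y w : (Fin n →₀ ℕ) → ℝ} {p : MvPolynomial (Fin n) ℝ} {d : ℕ}
    (hp : p.totalDegree ≤ d) (h : ∀ α : Fin n →₀ ℕ, α.degree ≤ d → y α = w α) :
    riesz y p = riesz w p :=
  Finset.sum_congr rfl fun α hα => by rw [h α ((degree_le_totalDegree hα).trans hp)]

theorem continuous_riesz (p : MvPolynomial (Fin n) ℝ) :
    Continuous fun y : (Fin n →₀ ℕ) → ℝ => riesz y p := by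
  unfold riesz; fun_prop

theorem riesz_sq_add (y : (Fin n →₀ ℕ) → ℝ) (p q : MvPolynomial (Fin n) ℝ) (t : ℝ) :
    riesz y ((p + t • q) * (p + t • q)) =
      riesz y (p * p) + 2 * t * riesz y (p * q) + t ^ 2 * riesz y (q * q) := by
  have : (p + t • q) * (p + t • q) = p * p + (2 * t) • (p * q) + (t ^ 2) • (q * q) := by
    simp only [MvPolynomial.smul_eq_C_mul, map_mul, map_pow, map_ofNat]; ring
  rw [this]; simp [riesz_add, riesz_smul]

/-! ### Semidefiniteness as polynomial inequalities -/

instance (r : ℕ) : Finite (Expo n r) := Finsupp.finite_of_degree_le r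

instance (r : ℕ) : Fintype (Expo n r) := Fintype.ofFinite _

/-- The polynomial with the given vector of coefficients. -/
def ofCoeffs {r : ℕ} (c : Expo n r → ℝ) : MvPolynomial (Fin n) ℝ :=
  ∑ β, MvPolynomial.monomial β.1 (c β)

theorem totalDegree_ofCoeffs {r : ℕ} (c : Expo n r → ℝ) : (ofCoeffs c).totalDegree ≤ r :=
  MvPolynomial.totalDegree_finsetSum_le fun β _ =>
    (MvPolynomial.totalDegree_monomial_le _ _).trans β.2

theorem exists_ofCoeffs {r : ℕ} {q : MvPolynomial (Fin n) ℝ} (hq : q.totalDegree ≤ r) :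
    ∃ c : Expo n r → ℝ, ofCoeffs c = q := by
  refine ⟨fun β => q.coeff β.1, ?_⟩
  ext α
  rw [ofCoeffs, MvPolynomial.coeff_sum]
  simp only [MvPolynomial.coeff_monomial]
  by_cases hα : α.degree ≤ r
  · rw [Finset.sum_eq_single ⟨α, hα⟩]
    · simp
    · intro β _ hβ
      rw [if_neg]; rintro rfl; exact hβ rfl
    · simp
  · rw [Finset.sum_eq_zero]
    · symm; by_contra h
      exact hα ((degree_le_totalDegree (MvPolynomial.mem_support_iff.2 h)).trans hq)
    · intro β _
      rw [if_neg]; rintro rfl; exact hα β.2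

theorem quadForm_locMatrix {s : ℕ} (g : MvPolynomial (Fin n) ℝ) (y : (Fin n →₀ ℕ) → ℝ)
    (c : Expo n s → ℝ) :
    c ⬝ᵥ (locMatrix s g y).mulVec c = riesz y (g * (ofCoeffs c * ofCoeffs c)) := by
  rw [ofCoeffs, Finset.sum_mul_sum]
  simp only [dotProduct, Matrix.mulVec, Finset.mul_sum, riesz_sum, locMatrix,
    MvPolynomial.monomial_mul]
  refine Finset.sum_congr rfl fun β _ => Finset.sum_congr rfl fun γ _ => ?_
  have : (MvPolynomial.monomial (β.1 + γ.1) (c β * c γ) : MvPolynomial (Fin n) ℝ) =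
      (c β * c γ) • MvPolynomial.monomial (β.1 + γ.1) 1 := by
    rw [MvPolynomial.smul_monomial, smul_eq_mul, mul_one]
  rw [this, mul_smul_comm, riesz_smul]; ring

theorem locMatrix_isHermitian (s : ℕ) (g : MvPolynomial (Fin n) ℝ) (y : (Fin n →₀ ℕ) → ℝ) :
    (locMatrix s g y).IsHermitian := by
  ext β γ
  simp [Matrix.conjTranspose_apply, locMatrix, add_comm]

theorem locMatrix_posSemidef_iff (s : ℕ) (g : MvPolynomial (Fin n) ℝ) (y : (Fin n →₀ ℕ) → ℝ) :
    (locMatrix s g y).PosSemidef ↔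
      ∀ q : MvPolynomial (Fin n) ℝ, q.totalDegree ≤ s → 0 ≤ riesz y (g * (q * q)) := by
  rw [Matrix.posSemidef_iff_dotProduct_mulVec]
  simp only [star_trivial, quadForm_locMatrix]
  refine ⟨fun h q hq => ?_, fun h => ⟨locMatrix_isHermitian s g y,
    fun c => h _ (totalDegree_ofCoeffs c)⟩⟩
  obtain ⟨c, rfl⟩ := exists_ofCoeffs hq
  exact h.2 c

theorem momMatrix_posSemidef_iff (s : ℕ) (y : (Fin n →₀ ℕ) → ℝ) :
    (momMatrix s y).PosSemidef ↔
      ∀ q : MvPolynomial (Fin n) ℝ, q.totalDegree ≤ s → 0 ≤ riesz y (q * q) := by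
  have h := locMatrix_posSemidef_iff s 1 y
  simp only [one_mul] at h
  exact h

theorem cInf_posSemidef_iff (X : Set (Fin n → ℝ)) (s : ℕ) (y : (Fin n →₀ ℕ) → ℝ) :
    (cInf X s y).PosSemidef ↔ ∀ q : MvPolynomial (Fin n) ℝ, q.totalDegree ≤ s →
      riesz y (q * q) ≤ riesz (moment (leb X)) (q * q) := by
  rw [Matrix.posSemidef_iff_dotProduct_mulVec]
  simp only [star_trivial, cInf, momMatrix, Matrix.sub_mulVec, dotProduct_sub, quadForm_locMatrix,
    one_mul, sub_nonneg]
  refine ⟨fun h q hq => ?_, fun h => ⟨(locMatrix_isHermitian _ _ _).sub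
    (locMatrix_isHermitian _ _ _), fun c => h _ (totalDegree_ofCoeffs c)⟩⟩
  obtain ⟨c, rfl⟩ := exists_ofCoeffs hq
  exact h.2 c

theorem cTwo_posSemidef_iff (X : Set (Fin n → ℝ)) (s : ℕ) (y : (Fin n →₀ ℕ) → ℝ) :
    (cTwo X s y).PosSemidef ↔ ∀ q : MvPolynomial (Fin n) ℝ, q.totalDegree ≤ s → ∀ t : ℝ,
      0 ≤ riesz (moment (leb X)) (q * q) + 2 * t * riesz y q + t ^ 2 := by
  rw [Matrix.posSemidef_iff_dotProduct_mulVec]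
  have key : ∀ (c : Expo n s → ℝ) (t : ℝ),
      Sum.elim c (fun _ : Unit => t) ⬝ᵥ (cTwo X s y).mulVec (Sum.elim c fun _ => t) =
        riesz (moment (leb X)) (ofCoeffs c * ofCoeffs c) + 2 * t * riesz y (ofCoeffs c) +
          t ^ 2 := by
    intro c t
    have h1 := quadForm_locMatrix 1 (moment (leb X)) c
    rw [one_mul] at h1
    have e₁ : ∀ β γ, cTwo X s y (Sum.inl β) (Sum.inl γ) =
      locMatrix s 1 (moment (leb X)) β γ := fun _ _ => rfl
    have e₂ : ∀ β i, cTwo X s y (Sum.inl β) (Sum.inr i) = y β.1 := fun _ _ => rfl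
    have e₃ : ∀ β i, cTwo X s y (Sum.inr i) (Sum.inl β) = y β.1 := fun _ _ => rfl
    have e₄ : ∀ i j, cTwo X s y (Sum.inr i) (Sum.inr j) = 1 := fun _ _ => rfl
    rw [← h1]
    simp only [ofCoeffs, riesz_sum, riesz_monomial, dotProduct, Fintype.sum_sum_type, Sum.elim_inl,
      Sum.elim_inr, Finset.univ_unique, Finset.sum_singleton, Matrix.mulVec, mul_add, e₁, e₂, e₃,
      e₄, Finset.sum_add_distrib, Finset.mul_sum]
    rw [add_assoc, add_assoc, ← add_assoc (∑ _, _) (∑ _, _) (t * _), ← Finset.sum_add_distrib]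
    congr 2
    · refine Finset.sum_congr rfl fun β _ => ?_
      ring
    · ring
  constructor
  · intro h q hq t
    obtain ⟨c, rfl⟩ := exists_ofCoeffs hq
    rw [← key]
    exact h.2 _
  · intro h
    refine ⟨?_, fun x => ?_⟩
    · exact Matrix.IsHermitian.fromBlocks (locMatrix_isHermitian _ _ _) (by ext; rfl)
        (Matrix.isHermitian_one)
    · have hx : x = Sum.elim (fun β => x (Sum.inl β)) (fun _ : Unit => x (Sum.inr ())) := by
        ext i; rcases i with i | i <;> rfl
      rw [star_trivial, hx, key]
      exact h _ (totalDegree_ofCoeffs _) _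

/-! ### Bounds on feasible points -/

/-- The constraints of the semidefinite program of order `r` other than the invariance equations,
for an infinite sequence `y`. -/
def PsdConstraints (g : Fin m → MvPolynomial (Fin n) ℝ) (p : ℝ≥0∞) (r : ℕ)
    (y : (Fin n →₀ ℕ) → ℝ) : Prop :=
  (p = 2 → (cTwo (semialgSet g) r y).PosSemidef) ∧
  (p = ∞ → (cInf (semialgSet g) r y).PosSemidef) ∧
  (momMatrix r y).PosSemidef ∧
  ∀ j, (locMatrix (r - halfDeg (g j)) (g j) y).PosSemidef

/-- The operator `q ↦ q ∘ f - q`, respectively `q ↦ grad q · f`. -/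
def invOp (k : TimeKind) (f : Fin n → MvPolynomial (Fin n) ℝ) (q : MvPolynomial (Fin n) ℝ) :
    MvPolynomial (Fin n) ℝ :=
  match k with
  | .discrete => MvPolynomial.bind₁ f q - q
  | .continuous => ∑ i, MvPolynomial.pderiv i q * f i

theorem invFunctional_eq_riesz (k : TimeKind) (f : Fin n → MvPolynomial (Fin n) ℝ)
    (y : (Fin n →₀ ℕ) → ℝ) (q : MvPolynomial (Fin n) ℝ) :
    invFunctional k f y q = riesz y (invOp k f q) := by
  cases k <;> simp [invFunctional, invOp, riesz_sub]

theorem halfDeg_le_of_rMin_le {g : Fin m → MvPolynomial (Fin n) ℝ} {r : ℕ} (hr : rMin g ≤ r)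
    (j : Fin m) : halfDeg (g j) ≤ r :=
  ((Finset.le_sup (f := fun j => halfDeg (g j)) (Finset.mem_univ j)).trans
    (le_max_right _ _)).trans hr

theorem totalDegree_loc_le {g : Fin m → MvPolynomial (Fin n) ℝ} {r : ℕ} (hr : rMin g ≤ r)
    (j : Fin m) {q : MvPolynomial (Fin n) ℝ} (hq : q.totalDegree ≤ r - halfDeg (g j)) :
    (g j * (q * q)).totalDegree ≤ 2 * r := by
  have h₁ := MvPolynomial.totalDegree_mul (g j) (q * q)
  have h₂ := MvPolynomial.totalDegree_mul q q
  have h₃ := halfDeg_le_of_rMin_le hr j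
  have h₄ : halfDeg (g j) = ((g j).totalDegree + 1) / 2 := rfl
  omega

theorem totalDegree_mul_self_le {r : ℕ} {q : MvPolynomial (Fin n) ℝ} (hq : q.totalDegree ≤ r) :
    (q * q).totalDegree ≤ 2 * r := by
  have := MvPolynomial.totalDegree_mul q q
  omega

theorem psdConstraints_iff (g : Fin m → MvPolynomial (Fin n) ℝ) (p : ℝ≥0∞) (r : ℕ)
    (y : (Fin n →₀ ℕ) → ℝ) : PsdConstraints g p r y ↔
      (p = 2 → ∀ q : MvPolynomial (Fin n) ℝ, q.totalDegree ≤ r → ∀ t : ℝ,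
        0 ≤ riesz (moment (leb (semialgSet g))) (q * q) + 2 * t * riesz y q + t ^ 2) ∧
      (p = ∞ → ∀ q : MvPolynomial (Fin n) ℝ, q.totalDegree ≤ r →
        riesz y (q * q) ≤ riesz (moment (leb (semialgSet g))) (q * q)) ∧
      (∀ q : MvPolynomial (Fin n) ℝ, q.totalDegree ≤ r → 0 ≤ riesz y (q * q)) ∧
      ∀ j, ∀ q : MvPolynomial (Fin n) ℝ, q.totalDegree ≤ r - halfDeg (g j) →
        0 ≤ riesz y (g j * (q * q)) := by
  unfold PsdConstraints
  simp only [cTwo_posSemidef_iff, cInf_posSemidef_iff, momMatrix_posSemidef_iff,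
    locMatrix_posSemidef_iff]

theorem PsdConstraints.congr {g : Fin m → MvPolynomial (Fin n) ℝ} {p : ℝ≥0∞} {r : ℕ}
    {y w : (Fin n →₀ ℕ) → ℝ} (hr : rMin g ≤ r) (hy : PsdConstraints g p r y)
    (h : ∀ α : Fin n →₀ ℕ, α.degree ≤ 2 * r → y α = w α) : PsdConstraints g p r w := by
  rw [psdConstraints_iff] at hy ⊢
  obtain ⟨h₂, hI, hM, hL⟩ := hy
  refine ⟨fun hp q hq t => ?_, fun hp q hq => ?_, fun q hq => ?_, fun j q hq => ?_⟩
  · rw [← riesz_congr (hq.trans (by omega)) h]; exact h₂ hp q hq t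
  · rw [← riesz_congr (totalDegree_mul_self_le hq) h]; exact hI hp q hq
  · rw [← riesz_congr (totalDegree_mul_self_le hq) h]; exact hM q hq
  · rw [← riesz_congr (totalDegree_loc_le hr j hq) h]; exact hL j q hq

theorem isClosed_psdConstraints (g : Fin m → MvPolynomial (Fin n) ℝ) (p : ℝ≥0∞) (r : ℕ) :
    IsClosed {y | PsdConstraints g p r y} := by
  simp only [psdConstraints_iff, Set.ofPred_and, Set.ofPred_forall]
  have := @continuous_riesz n
  refine IsClosed.inter ?_ (IsClosed.inter ?_ (IsClosed.inter ?_ ?_))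
  · refine isClosed_iInter fun _ => isClosed_iInter fun q => isClosed_iInter fun _ =>
      isClosed_iInter fun t => isClosed_le continuous_const ?_
    have := this q
    fun_prop
  · exact isClosed_iInter fun _ => isClosed_iInter fun q => isClosed_iInter fun _ =>
      isClosed_le (this _) continuous_const
  · exact isClosed_iInter fun q => isClosed_iInter fun _ => isClosed_le continuous_const (this _)
  · exact isClosed_iInter fun j => isClosed_iInter fun q => isClosed_iInter fun _ =>
      isClosed_le continuous_const (this _)

/-- A bound, valid for every order `r`, on the moments of order at most `2 r` of feasible points;
`N` is the integer of the polynomial `N - ‖x‖²`. -/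
def momentBound (X : Set (Fin n → ℝ)) (N : ℤ) (α : Fin n →₀ ℕ) : ℝ :=
  (max 1 (N : ℝ)) ^ α.degree * (moment (leb X) 0 + 1)

theorem moment_zero (μ : Measure (Fin n → ℝ)) : moment μ 0 = μ.real Set.univ := by
  simp [moment]

theorem PsdConstraints.apply_zero_le {g : Fin m → MvPolynomial (Fin n) ℝ} {p : ℝ≥0∞}
    (hp : p = 2 ∨ p = ∞) {r : ℕ} {y : (Fin n →₀ ℕ) → ℝ} (hy : PsdConstraints g p r y) :
    y 0 ≤ moment (leb (semialgSet g)) 0 + 1 := by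
  have hz : 0 ≤ moment (leb (semialgSet g)) 0 := by rw [moment_zero]; exact measureReal_nonneg
  obtain ⟨h₂, hI, -, -⟩ := (psdConstraints_iff g p r y).1 hy
  have e : ∀ w : (Fin n →₀ ℕ) → ℝ, riesz w 1 = w 0 := fun w => by
    have := riesz_monomial w 0 1
    rwa [one_mul] at this
  rcases hp with hp | hp
  · -- The choice `t = -y₀` gives `y₀² ≤ z₀`.
    have := h₂ hp 1 (by simp) (-y 0)
    rw [one_mul, e, e] at this
    nlinarith
  · have := hI hp 1 (by simp)
    rw [one_mul, e, e] at this
    linarith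

theorem riesz_monomial_mul_self (y : (Fin n →₀ ℕ) → ℝ) (β : Fin n →₀ ℕ) :
    riesz y (MvPolynomial.monomial β 1 * MvPolynomial.monomial β 1) = y (β + β) := by
  rw [MvPolynomial.monomial_mul, riesz_monomial]; ring

theorem totalDegree_monomial_le' {β : Fin n →₀ ℕ} {r : ℕ} (h : β.degree ≤ r) :
    (MvPolynomial.monomial β (1 : ℝ)).totalDegree ≤ r :=
  (MvPolynomial.totalDegree_monomial_le _ _).trans h

/-- The localizing constraint of `N - ‖x‖²` bounds `y (2β + 2eᵢ)` by `N y (2β)`. -/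
theorem PsdConstraints.apply_step_le {g : Fin m → MvPolynomial (Fin n) ℝ} {p : ℝ≥0∞} {r : ℕ}
    {y : (Fin n →₀ ℕ) → ℝ} (hy : PsdConstraints g p r y) {j : Fin m} {N : ℤ}
    (hj : g j = MvPolynomial.C (N : ℝ) - ∑ i : Fin n, (MvPolynomial.X i) ^ 2)
    {β : Fin n →₀ ℕ} (hβ : β.degree + 1 ≤ r) (i : Fin n) :
    y ((β + Finsupp.single i 1) + (β + Finsupp.single i 1)) ≤ max 1 (N : ℝ) * y (β + β) := by
  obtain ⟨-, -, hM, hL⟩ := (psdConstraints_iff g p r y).1 hy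
  have hpos : ∀ i, 0 ≤ y ((β + Finsupp.single i 1) + (β + Finsupp.single i 1)) := fun i => by
    rw [← riesz_monomial_mul_self y]
    refine hM _ (totalDegree_monomial_le' ?_)
    rw [map_add, Finsupp.degree_single]; exact hβ
  have hpos' : 0 ≤ y (β + β) := by
    rw [← riesz_monomial_mul_self y]
    exact hM _ (totalDegree_monomial_le' (by omega))
  have hdeg : (g j).totalDegree ≤ 2 := by
    rw [hj]
    refine (MvPolynomial.totalDegree_sub _ _).trans (max_le ?_ ?_)
    · rw [MvPolynomial.totalDegree_C]; omega
    exact MvPolynomial.totalDegree_finsetSum_le fun i _ => by simp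
  have key := hL j (MvPolynomial.monomial β 1) (totalDegree_monomial_le' (by
    have : halfDeg (g j) = ((g j).totalDegree + 1) / 2 := rfl
    omega))
  have e : g j * (MvPolynomial.monomial β 1 * MvPolynomial.monomial β 1) =
      MvPolynomial.monomial (β + β) (N : ℝ) - ∑ i : Fin n, MvPolynomial.monomial
        ((β + Finsupp.single i 1) + (β + Finsupp.single i 1)) (1 : ℝ) := by
    rw [hj, MvPolynomial.monomial_mul, sub_mul, MvPolynomial.C_mul_monomial, Finset.sum_mul,
      mul_one, mul_one]
    congr 1
    refine Finset.sum_congr rfl fun i _ => ?_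
    rw [MvPolynomial.X_pow_eq_monomial, MvPolynomial.monomial_mul, mul_one]
    have : (Finsupp.single i 2 : Fin n →₀ ℕ) = Finsupp.single i 1 + Finsupp.single i 1 := by
      rw [← Finsupp.single_add]
    rw [this, add_add_add_comm, add_comm β]
  rw [e, riesz_sub, riesz_sum] at key
  simp only [riesz_monomial, one_mul] at key
  have h₁ := Finset.single_le_sum (fun i _ => hpos i) (Finset.mem_univ i)
  have h₂ : (N : ℝ) * y (β + β) ≤ max 1 (N : ℝ) * y (β + β) :=
    mul_le_mul_of_nonneg_right (le_max_right _ _) hpos'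
  linarith

theorem PsdConstraints.apply_double_le {g : Fin m → MvPolynomial (Fin n) ℝ} {p : ℝ≥0∞} {r : ℕ}
    {y : (Fin n →₀ ℕ) → ℝ} (hy : PsdConstraints g p r y) {j : Fin m} {N : ℤ}
    (hj : g j = MvPolynomial.C (N : ℝ) - ∑ i : Fin n, (MvPolynomial.X i) ^ 2) (d : ℕ) :
    ∀ β : Fin n →₀ ℕ, β.degree = d → d ≤ r → y (β + β) ≤ max 1 (N : ℝ) ^ d * y 0 := by
  induction d with
  | zero =>
    intro β hβ _
    rw [Finsupp.degree_eq_zero_iff] at hβ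
    simp [hβ]
  | succ d ih =>
    intro β hβ hd
    obtain ⟨i, hi⟩ : ∃ i, β i ≠ 0 := by
      by_contra! h
      have : β = 0 := by ext i; simpa using h i
      rw [this] at hβ
      simp at hβ
    have hle : Finsupp.single i 1 ≤ β := by
      rw [Finsupp.single_le_iff]; omega
    obtain ⟨γ, rfl⟩ : ∃ γ, β = γ + Finsupp.single i 1 := ⟨_, (tsub_add_cancel_of_le hle).symm⟩
    rw [map_add, Finsupp.degree_single] at hβ
    have h₁ := hy.apply_step_le hj (β := γ) (by omega) i
    have h₂ := ih γ (by omega) (by omega)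
    have h₃ : (0 : ℝ) ≤ max 1 (N : ℝ) := zero_le_one.trans (le_max_left _ _)
    calc _ ≤ _ := h₁
      _ ≤ max 1 (N : ℝ) * (max 1 (N : ℝ) ^ d * y 0) := mul_le_mul_of_nonneg_left h₂ h₃
      _ = _ := by ring

theorem PsdConstraints.abs_le {g : Fin m → MvPolynomial (Fin n) ℝ} {p : ℝ≥0∞}
    (hp : p = 2 ∨ p = ∞) {r : ℕ} {y : (Fin n →₀ ℕ) → ℝ} (hy : PsdConstraints g p r y)
    {j : Fin m} {N : ℤ} (hj : g j = MvPolynomial.C (N : ℝ) - ∑ i : Fin n, (MvPolynomial.X i) ^ 2)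
    {α : Fin n →₀ ℕ} (hα : α.degree ≤ 2 * r) : |y α| ≤ momentBound (semialgSet g) N α := by
  -- Split `α = β + γ` with `|β|, |γ| ≤ r` and use `ℓ_y((x^β ± x^γ)²) ≥ 0`.
  obtain ⟨β, γ, rfl, hβ, hγ⟩ : ∃ β γ : Fin n →₀ ℕ, α = β + γ ∧ β.degree ≤ r ∧ γ.degree ≤ r := by
    obtain ⟨β, hβ, hd⟩ := Finsupp.exists_le_degree_eq α (min r α.degree) (min_le_right _ _)
    refine ⟨β, α - β, (add_tsub_cancel_of_le hβ).symm, by omega, ?_⟩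
    have := congrArg Finsupp.degree (add_tsub_cancel_of_le hβ)
    rw [map_add] at this
    omega
  have h1 : (1 : ℝ) ≤ max 1 (N : ℝ) := le_max_left _ _
  have hz : 0 ≤ moment (leb (semialgSet g)) 0 := by rw [moment_zero]; exact measureReal_nonneg
  have bound : ∀ δ : Fin n →₀ ℕ, δ.degree ≤ r → δ.degree ≤ (β + γ).degree →
      y (δ + δ) ≤ momentBound (semialgSet g) N (β + γ) := fun δ hδ hδ' => by
    refine (hy.apply_double_le hj _ δ rfl hδ).trans ?_
    exact (mul_le_mul_of_nonneg_left (hy.apply_zero_le hp) (by positivity)).trans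
      (mul_le_mul_of_nonneg_right (pow_le_pow_right₀ h1 hδ') (by positivity))
  have bβ := bound β hβ (by rw [map_add]; omega)
  have bγ := bound γ hγ (by rw [map_add]; omega)
  have hM := ((psdConstraints_iff g p r y).1 hy).2.2.1
  have hpm : ∀ t : ℝ, 0 ≤ y (β + β) + 2 * t * y (β + γ) + t ^ 2 * y (γ + γ) := fun t => by
    have := hM (MvPolynomial.monomial β 1 + t • MvPolynomial.monomial γ 1) (by
      refine (MvPolynomial.totalDegree_add _ _).trans (max_le (totalDegree_monomial_le' hβ) ?_)
      exact (MvPolynomial.totalDegree_smul_le _ _).trans (totalDegree_monomial_le' hγ))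
    rw [riesz_sq_add, riesz_monomial_mul_self, riesz_monomial_mul_self,
      MvPolynomial.monomial_mul, riesz_monomial] at this
    linarith
  have h₁ := hpm 1
  have h₂ := hpm (-1)
  rw [_root_.abs_le]
  constructor <;> linarith

/-! ### Truncated sequences and existence of optimal solutions -/

theorem zeroExt_of_le {d : ℕ} (y : Expo n d → ℝ) {α : Fin n →₀ ℕ} (h : α.degree ≤ d) :
    zeroExt y α = y ⟨α, h⟩ := dif_pos h

theorem zeroExt_add {d : ℕ} (y w : Expo n d → ℝ) : zeroExt (y + w) = zeroExt y + zeroExt w := by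
  ext α; by_cases h : α.degree ≤ d <;> simp [zeroExt, h]

theorem zeroExt_smul {d : ℕ} (c : ℝ) (y : Expo n d → ℝ) : zeroExt (c • y) = c • zeroExt y := by
  ext α; by_cases h : α.degree ≤ d <;> simp [zeroExt, h]

theorem continuous_zeroExt (d : ℕ) : Continuous (zeroExt : (Expo n d → ℝ) → _) := by
  refine continuous_pi fun α => ?_
  by_cases h : α.degree ≤ d <;> simp only [zeroExt, h, dite_true, dite_false] <;> fun_prop

theorem riesz_add_left (y w : (Fin n →₀ ℕ) → ℝ) (p : MvPolynomial (Fin n) ℝ) :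
    riesz (y + w) p = riesz y p + riesz w p := by
  simp [riesz, mul_add, Finset.sum_add_distrib]

theorem riesz_smul_left (c : ℝ) (y : (Fin n →₀ ℕ) → ℝ) (p : MvPolynomial (Fin n) ℝ) :
    riesz (c • y) p = c * riesz y p := by
  simp [riesz, Finset.mul_sum, mul_left_comm]

/-- The subspace of vectors satisfying the invariance equations of order `r`. -/
def invSubspace (k : TimeKind) (f : Fin n → MvPolynomial (Fin n) ℝ) (r : ℕ) :
    Submodule ℝ (Expo n (sdpDegree f r) → ℝ) where
  carrier := {y | ∀ α : Fin n →₀ ℕ, α.degree ≤ 2 * r →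
    invFunctional k f (zeroExt y) (MvPolynomial.monomial α 1) = 0}
  add_mem' {y w} hy hw α hα := by
    have h₁ := hy α hα
    have h₂ := hw α hα
    rw [invFunctional_eq_riesz] at h₁ h₂ ⊢
    rw [zeroExt_add, riesz_add_left, h₁, h₂, add_zero]
  zero_mem' α hα := by
    have : zeroExt (0 : Expo n (sdpDegree f r) → ℝ) = 0 := by ext; simp [zeroExt]
    rw [invFunctional_eq_riesz, this]
    simp [riesz]
  smul_mem' c y hy α hα := by
    have h₁ := hy α hα
    rw [invFunctional_eq_riesz] at h₁ ⊢
    rw [zeroExt_smul, riesz_smul_left, h₁, mul_zero]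

/-- Restriction to the moments of order at most `e`. -/
def truncate (d e : ℕ) : (Expo n d → ℝ) →ₗ[ℝ] (Expo n e → ℝ) where
  toFun y β := zeroExt y β.1
  map_add' y w := by ext β; simp [zeroExt_add]
  map_smul' c y := by ext β; simp [zeroExt_smul]

theorem zeroExt_truncate {d e : ℕ} (y : Expo n d → ℝ) {α : Fin n →₀ ℕ} (h : α.degree ≤ e) :
    zeroExt (truncate d e y) α = zeroExt y α := zeroExt_of_le _ h

/-- Only the moments of order at most `2 r` are bounded by the constraints, so compactness is used
after projecting to these. The projection of the feasible set is closed because the image of the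
subspace of solutions of the invariance equations is a subspace of a finite-dimensional space. -/
theorem exists_sdpOptimal {k : TimeKind} {f : Fin n → MvPolynomial (Fin n) ℝ}
    {g : Fin m → MvPolynomial (Fin n) ℝ} (hg : Archimedean g) {p : ℝ≥0∞} (hp : p = 2 ∨ p = ∞)
    {r : ℕ} (hr : rMin g ≤ r) (hne : ∃ y, SdpFeasible k f g p r y) :
    ∃ y, SdpOptimal k f g p r y := by
  obtain ⟨j, N, hj⟩ := hg
  set π := truncate (n := n) (sdpDegree f r) (2 * r)
  set K : Set (Expo n (2 * r) → ℝ) :=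
    ((invSubspace k f r).map π : Set _) ∩ zeroExt ⁻¹' {y | PsdConstraints g p r y} with hK
  have hmem : ∀ y, SdpFeasible k f g p r y → π y ∈ K := fun y hy =>
    ⟨⟨y, hy.1, rfl⟩, PsdConstraints.congr hr hy.2 fun α hα => (zeroExt_truncate y hα).symm⟩
  have hclosed : IsClosed K :=
    (Submodule.closed_of_finiteDimensional _).inter
      ((isClosed_psdConstraints g p r).preimage (continuous_zeroExt _))
  have hsub : K ⊆ Set.univ.pi fun β => Set.Icc (-momentBound (semialgSet g) N β.1)
      (momentBound (semialgSet g) N β.1) := by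
    rintro w ⟨-, hw⟩ β -
    have := PsdConstraints.abs_le hp hw hj β.2
    rw [zeroExt_of_le _ β.2] at this
    exact _root_.abs_le.1 this
  have hcomp : IsCompact K :=
    (isCompact_univ_pi fun _ => isCompact_Icc).of_isClosed_subset hclosed hsub
  obtain ⟨y₀, hy₀⟩ := hne
  obtain ⟨w, hwK, hw⟩ := hcomp.exists_isMaxOn ⟨_, hmem _ hy₀⟩
    (((continuous_apply 0).comp (continuous_zeroExt _)).continuousOn)
  obtain ⟨⟨y, hy, rfl⟩, hP⟩ := hwK
  refine ⟨y, ⟨hy, PsdConstraints.congr hr hP fun α hα => zeroExt_truncate y hα⟩, fun v hv => ?_⟩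
  have := hw (hmem v hv)
  simpa [π, zeroExt_truncate] using this

/-! ### Polynomials and measures on compact sets -/

theorem exists_polynomial_near {K : Set (Fin n → ℝ)} (hK : IsCompact K)
    {φ : (Fin n → ℝ) → ℝ} (hφ : Continuous φ) {ε : ℝ} (hε : 0 < ε) :
    ∃ q : MvPolynomial (Fin n) ℝ, ∀ x ∈ K, |MvPolynomial.eval x q - φ x| < ε := by
  let Φ : MvPolynomial (Fin n) ℝ →ₐ[ℝ] C(Fin n → ℝ, ℝ) :=
    MvPolynomial.aeval fun i => ⟨fun x => x i, continuous_apply i⟩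
  have hΦ : ∀ q x, Φ q x = MvPolynomial.eval x q := fun q x => by
    induction q using MvPolynomial.induction_on with
    | C a => simp [Φ]
    | add p q hp hq => simp [hp, hq]
    | mul_X p i hp => simp [hp]; left; simp [Φ]
  have hsep : (Φ.range : Subalgebra ℝ C(Fin n → ℝ, ℝ)).SeparatesPoints := by
    intro x y hxy
    obtain ⟨i, hi⟩ := Function.ne_iff.1 hxy
    refine ⟨Φ (MvPolynomial.X i), ⟨Φ (MvPolynomial.X i), ⟨_, rfl⟩, rfl⟩, ?_⟩
    simpa [hΦ] using hi
  obtain ⟨_, ⟨q, rfl⟩, hq⟩ :=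
    ContinuousMap.exists_mem_subalgebra_near_continuous_of_isCompact_of_separatesPoints hsep
      ⟨φ, hφ⟩ hK hε
  exact ⟨q, fun x hx => by simpa [hΦ] using hq x hx⟩

theorem exists_bound_of_continuous {K : Set (Fin n → ℝ)} (hK : IsCompact K)
    {φ : (Fin n → ℝ) → ℝ} (hφ : Continuous φ) : ∃ C : ℝ, 0 ≤ C ∧ ∀ x ∈ K, |φ x| ≤ C := by
  obtain ⟨C, hC⟩ := hK.exists_bound_of_continuousOn hφ.continuousOn
  exact ⟨max C 0, le_max_right _ _, fun x hx => (hC x hx).trans (le_max_left _ _)⟩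

theorem ae_mem_of_measure_compl {μ : Measure (Fin n → ℝ)} {K : Set (Fin n → ℝ)}
    (hμ : μ Kᶜ = 0) : ∀ᵐ x ∂μ, x ∈ K := by
  rw [ae_iff]; exact hμ

theorem memLp_of_continuous {μ : Measure (Fin n → ℝ)} [IsFiniteMeasure μ]
    {K : Set (Fin n → ℝ)} (hK : IsCompact K) (hμ : μ Kᶜ = 0) {φ : (Fin n → ℝ) → ℝ}
    (hφ : Continuous φ) (p : ℝ≥0∞) : MemLp φ p μ := by
  obtain ⟨C, -, hC⟩ := exists_bound_of_continuous hK hφ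
  refine MemLp.of_bound hφ.aestronglyMeasurable C ?_
  filter_upwards [ae_mem_of_measure_compl hμ] with x hx using hC x hx

theorem integrable_of_continuous {μ : Measure (Fin n → ℝ)} [IsFiniteMeasure μ]
    {K : Set (Fin n → ℝ)} (hK : IsCompact K) (hμ : μ Kᶜ = 0) {φ : (Fin n → ℝ) → ℝ}
    (hφ : Continuous φ) : Integrable φ μ :=
  memLp_one_iff_integrable.1 (memLp_of_continuous hK hμ hφ 1)

theorem eval_monomial_one (x : Fin n → ℝ) (α : Fin n →₀ ℕ) :
    MvPolynomial.eval x (MvPolynomial.monomial α 1) = ∏ i, x i ^ α i := by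
  rw [MvPolynomial.eval_monomial, one_mul, Finsupp.prod_fintype]
  simp

/-- Moments of a measure on a compact set represent the integrals of polynomials. -/
theorem riesz_moment {μ : Measure (Fin n → ℝ)} [IsFiniteMeasure μ] {K : Set (Fin n → ℝ)}
    (hK : IsCompact K) (hμ : μ Kᶜ = 0) (q : MvPolynomial (Fin n) ℝ) :
    riesz (moment μ) q = ∫ x, MvPolynomial.eval x q ∂μ := by
  simp only [riesz, moment, MvPolynomial.eval_eq']
  rw [integral_finsetSum]
  · simp only [integral_const_mul]
  · intro β _
    exact integrable_of_continuous hK hμ (by fun_prop)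

theorem abs_integral_mul_sub_le {μ : Measure (Fin n → ℝ)} [IsFiniteMeasure μ]
    {K : Set (Fin n → ℝ)} (hK : IsCompact K) (hμ : μ Kᶜ = 0) {h φ ψ : (Fin n → ℝ) → ℝ}
    (hh : Integrable h μ) (hφ : Continuous φ) (hψ : Continuous ψ) {δ : ℝ}
    (hδ : ∀ x ∈ K, |φ x - ψ x| ≤ δ) :
    |∫ x, h x * φ x ∂μ - ∫ x, h x * ψ x ∂μ| ≤ δ * ∫ x, |h x| ∂μ := by
  have hint : ∀ {χ : (Fin n → ℝ) → ℝ}, Continuous χ → Integrable (fun x => h x * χ x) μ :=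
    fun {χ} hχ => by
      obtain ⟨C, -, hC⟩ := exists_bound_of_continuous hK hχ
      refine hh.mul_bdd (c := C) hχ.aestronglyMeasurable ?_
      filter_upwards [ae_mem_of_measure_compl hμ] with x hx using hC x hx
  rw [← integral_sub (hint hφ) (hint hψ), ← integral_const_mul]
  rw [← Real.norm_eq_abs]
  refine norm_integral_le_of_norm_le (hh.abs.const_mul δ) ?_
  filter_upwards [ae_mem_of_measure_compl hμ] with x hx
  rw [← mul_sub, Real.norm_eq_abs, abs_mul, mul_comm]
  exact mul_le_mul_of_nonneg_right (hδ x hx) (abs_nonneg _)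

/-- Nonnegativity of the integrals of squares against a density passes from polynomials to
continuous functions. -/
theorem integral_mul_sq_nonneg_of_polynomial {μ : Measure (Fin n → ℝ)} [IsFiniteMeasure μ]
    {K : Set (Fin n → ℝ)} (hK : IsCompact K) (hμ : μ Kᶜ = 0) {h : (Fin n → ℝ) → ℝ}
    (hh : Integrable h μ)
    (hq : ∀ q : MvPolynomial (Fin n) ℝ, 0 ≤ ∫ x, h x * MvPolynomial.eval x (q * q) ∂μ)
    {ψ : (Fin n → ℝ) → ℝ} (hψ : Continuous ψ) : 0 ≤ ∫ x, h x * (ψ x * ψ x) ∂μ := by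
  obtain ⟨C, hC0, hC⟩ := exists_bound_of_continuous hK hψ
  set A := ∫ x, |h x| ∂μ
  have hA : 0 ≤ A := integral_nonneg fun x => abs_nonneg _
  refine le_of_forall_pos_le_add fun ε hε => ?_
  obtain ⟨δ, hδ, hδ1, hδε⟩ : ∃ δ : ℝ, 0 < δ ∧ δ ≤ 1 ∧ δ * ((2 * C + 1) * A) ≤ ε := by
    refine ⟨min 1 (ε / ((2 * C + 1) * A + 1)), by positivity, min_le_left _ _, ?_⟩
    calc _ ≤ ε / ((2 * C + 1) * A + 1) * ((2 * C + 1) * A + 1) :=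
          mul_le_mul (min_le_right _ _) (by linarith) (by positivity) (by positivity)
      _ = ε := div_mul_cancel₀ _ (by positivity)
  obtain ⟨q, hqK⟩ := exists_polynomial_near hK hψ hδ
  have := abs_integral_mul_sub_le hK hμ hh (MvPolynomial.continuous_eval (q * q))
    (ψ := fun x => ψ x * ψ x) (hψ.mul hψ) (δ := δ * (2 * C + 1)) (fun x hx => by
      have h₁ := hqK x hx
      have h₂ := hC x hx
      rw [map_mul, mul_self_sub_mul_self, abs_mul, mul_comm]
      refine mul_le_mul h₁.le ?_ (abs_nonneg _) hδ.le
      rw [abs_lt] at h₁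
      rw [abs_le] at h₂ ⊢
      constructor <;> linarith)
  rw [abs_le] at this
  have h₀ := hq q
  have h₃ : δ * (2 * C + 1) * A = δ * ((2 * C + 1) * A) := by ring
  linarith [this.2]

/-- Finite measures on a compact set are determined by the integrals of polynomials. -/
theorem measure_eq_of_polynomial {μ ν : Measure (Fin n → ℝ)} [IsFiniteMeasure μ]
    [IsFiniteMeasure ν] {K : Set (Fin n → ℝ)} (hK : IsCompact K) (hμ : μ Kᶜ = 0)
    (hν : ν Kᶜ = 0)
    (h : ∀ q : MvPolynomial (Fin n) ℝ,
      ∫ x, MvPolynomial.eval x q ∂μ = ∫ x, MvPolynomial.eval x q ∂ν) : μ = ν := by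
  refine ext_of_forall_integral_eq_of_IsFiniteMeasure fun φ => ?_
  refine eq_of_forall_dist_le fun ε hε => ?_
  set A := μ.real Set.univ + ν.real Set.univ
  have hA : 0 ≤ A := by positivity
  obtain ⟨q, hq⟩ := exists_polynomial_near hK φ.continuous (ε := ε / (A + 1)) (by positivity)
  have key : ∀ (κ : Measure (Fin n → ℝ)) [IsFiniteMeasure κ], κ Kᶜ = 0 →
      |∫ x, MvPolynomial.eval x q ∂κ - ∫ x, φ x ∂κ| ≤ ε / (A + 1) * κ.real Set.univ := by
    intro κ _ hκ
    simpa using abs_integral_mul_sub_le hK hκ (integrable_const (1 : ℝ))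
      (MvPolynomial.continuous_eval q) φ.continuous fun x hx => (hq x hx).le
  have h₁ := key μ hμ
  have h₂ := key ν hν
  have h₃ : ε / (A + 1) * A ≤ ε := by
    rw [div_mul_eq_mul_div, div_le_iff₀ (by positivity)]
    nlinarith
  have h₄ : ε / (A + 1) * A =
      ε / (A + 1) * μ.real Set.univ + ε / (A + 1) * ν.real Set.univ := by
    rw [← mul_add]
  rw [Real.dist_eq]
  rw [h q] at h₁
  rw [abs_le] at h₁ h₂ ⊢
  constructor <;> linarith [h₁.1, h₁.2, h₂.1, h₂.2]

/-- The condition `0 ≤ ⟪h, u⁺⟫` is closed in `u ∈ L²`, so that it may be checked on bounded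
continuous `u`; taking `u = -h` shows that the negative part of `h` vanishes. -/
theorem ae_nonneg_of_polynomial {μ : Measure (Fin n → ℝ)} [IsFiniteMeasure μ]
    {K : Set (Fin n → ℝ)} (hK : IsCompact K) (hμ : μ Kᶜ = 0) {h : (Fin n → ℝ) → ℝ}
    (hh : MemLp h 2 μ)
    (hq : ∀ q : MvPolynomial (Fin n) ℝ, 0 ≤ ∫ x, h x * MvPolynomial.eval x (q * q) ∂μ) :
    0 ≤ᵐ[μ] h := by
  have hint : Integrable h μ := hh.integrable (by norm_num)
  let H : Lp ℝ 2 μ := hh.toLp h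
  have hH : H =ᵐ[μ] h := hh.coeFn_toLp
  have hall : ∀ u : Lp ℝ 2 μ, 0 ≤ inner ℝ H (Lp.posPart u) := by
    have hclosed : IsClosed {u : Lp ℝ 2 μ | 0 ≤ inner ℝ H (Lp.posPart u)} :=
      isClosed_le continuous_const
        (continuous_const.inner Lp.continuous_posPart)
    intro u
    refine (BoundedContinuousFunction.toLp_denseRange ℝ μ ℝ (p := 2)
      (by norm_num)).induction_on (p := fun u => 0 ≤ inner ℝ H (Lp.posPart u)) u hclosed
      fun φ => ?_
    have hψ : Continuous fun x => √(max (φ x) 0) :=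
      Real.continuous_sqrt.comp (φ.continuous.max continuous_const)
    refine (integral_mul_sq_nonneg_of_polynomial hK hμ hint hq hψ).trans_eq ?_
    rw [L2.inner_def]
    refine integral_congr_ae ?_
    filter_upwards [hH, Lp.coeFn_posPart (BoundedContinuousFunction.toLp 2 μ ℝ φ),
      BoundedContinuousFunction.coeFn_toLp (p := 2) (𝕜 := ℝ) μ φ] with x h₁ h₂ h₃
    rw [h₁, h₂, h₃, Real.mul_self_sqrt (le_max_right _ _)]
    simp [mul_comm]
  have h₀ := hall (-H)
  rw [L2.inner_def] at h₀
  have hneg : ∀ᵐ x ∂μ, inner ℝ (H x) (Lp.posPart (-H) x) = -(max (-h x) 0) ^ 2 := by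
    filter_upwards [hH, Lp.coeFn_posPart (-H), Lp.coeFn_neg H] with x h₁ h₂ h₃
    rw [h₂, h₃, Pi.neg_apply, h₁]
    rcases le_total 0 (h x) with h0 | h0
    · simp [h0]
    · simp [h0]; ring
  rw [integral_congr_ae hneg, integral_neg, neg_nonneg] at h₀
  have hi : Integrable (fun x => (max (-h x) 0) ^ 2) μ := by
    have := (MemLp.pos_part hh.neg).integrable_sq
    simpa using this
  have h₁ := (integral_eq_zero_iff_of_nonneg (fun x => sq_nonneg _) hi).1
    (le_antisymm h₀ (integral_nonneg fun x => sq_nonneg _))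
  filter_upwards [h₁] with x hx
  have : max (-h x) 0 = 0 := by simpa using hx
  have := le_max_left (-h x) 0
  simp only [Pi.zero_apply]
  linarith

/-- A functional on a vector space dominated by the norm of its image in a Hilbert space is
represented by a vector. -/
theorem exists_inner_eq_of_le_norm {V H : Type*} [AddCommGroup V] [Module ℝ V]
    [NormedAddCommGroup H] [InnerProductSpace ℝ H] [CompleteSpace H] (T : V →ₗ[ℝ] H)
    (l : V →ₗ[ℝ] ℝ) {C : ℝ} (hC : 0 ≤ C) (h : ∀ v, |l v| ≤ C * ‖T v‖) :
    ∃ u : H, ‖u‖ ≤ C ∧ ∀ v, l v = inner ℝ u (T v) := by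
  obtain ⟨s, hs⟩ := T.rangeRestrict.exists_rightInverse_of_surjective T.range_rangeRestrict
  have hs' : ∀ w : LinearMap.range T, T (s w) = w := fun w =>
    congrArg Subtype.val (LinearMap.congr_fun hs w)
  let φ : StrongDual ℝ (LinearMap.range T) :=
    (l.comp s).mkContinuous C fun w => by
      have := h (s w)
      rwa [hs'] at this
  obtain ⟨Φ, hΦ, hnorm⟩ := _root_.exists_extension_norm_eq (LinearMap.range T) φ
  refine ⟨(InnerProductSpace.toDual ℝ H).symm Φ, ?_, fun v => ?_⟩
  · rw [LinearIsometryEquiv.norm_map, hnorm]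
    exact LinearMap.mkContinuous_norm_le _ hC _
  · rw [InnerProductSpace.toDual_symm_apply, hΦ ⟨T v, v, rfl⟩]
    have h₁ := h (v - s ⟨T v, v, rfl⟩)
    rw [map_sub, map_sub, hs', sub_self, norm_zero, mul_zero] at h₁
    exact sub_eq_zero.1 (abs_nonpos_iff.1 h₁)

/-- A moment functional dominated by the `L²(μ)` norm has a density in `L²(μ)`. -/
theorem exists_density_of_riesz_sq_le {μ : Measure (Fin n → ℝ)} [IsFiniteMeasure μ]
    {K : Set (Fin n → ℝ)} (hK : IsCompact K) (hμ : μ Kᶜ = 0) {y : (Fin n →₀ ℕ) → ℝ} {C : ℝ}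
    (hC : 0 ≤ C)
    (h : ∀ q, riesz y q ^ 2 ≤ C ^ 2 * ∫ x, MvPolynomial.eval x (q * q) ∂μ) :
    ∃ u : (Fin n → ℝ) → ℝ, MemLp u 2 μ ∧ eLpNorm u 2 μ ≤ ENNReal.ofReal C ∧
      ∀ q, riesz y q = ∫ x, u x * MvPolynomial.eval x q ∂μ := by
  have hmem : ∀ q : MvPolynomial (Fin n) ℝ, MemLp (fun x => MvPolynomial.eval x q) 2 μ :=
    fun q => memLp_of_continuous hK hμ (MvPolynomial.continuous_eval q) 2
  let T : MvPolynomial (Fin n) ℝ →ₗ[ℝ] Lp ℝ 2 μ :=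
    { toFun := fun q => (hmem q).toLp _
      map_add' := fun p q => by
        rw [← MemLp.toLp_add]
        exact MemLp.toLp_congr _ _ (ae_of_all _ fun x => by simp)
      map_smul' := fun c q => by
        rw [RingHom.id_apply, ← MemLp.toLp_const_smul]
        exact MemLp.toLp_congr _ _ (ae_of_all _ fun x => by simp) }
  have hT : ∀ q, T q =ᵐ[μ] fun x => MvPolynomial.eval x q := fun q => (hmem q).coeFn_toLp
  have hnorm : ∀ q, ‖T q‖ ^ 2 = ∫ x, MvPolynomial.eval x (q * q) ∂μ := fun q => by
    rw [← real_inner_self_eq_norm_sq, L2.inner_def]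
    refine integral_congr_ae ?_
    filter_upwards [hT q] with x hx
    rw [hx]; simp [sq]
  obtain ⟨u, hu, hrep⟩ := exists_inner_eq_of_le_norm T (rieszLin y) hC fun q => by
    have := h q
    rw [← hnorm, ← mul_pow] at this
    exact abs_le_of_sq_le_sq this (by positivity)
  refine ⟨u, Lp.memLp u, ?_, fun q => ?_⟩
  · rw [← ENNReal.ofReal_toReal (Lp.eLpNorm_ne_top u)]
    exact ENNReal.ofReal_le_ofReal hu
  · rw [← rieszLin_apply, hrep, L2.inner_def]
    refine integral_congr_ae ?_
    filter_upwards [hT q] with x hx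
    rw [hx]; simp [mul_comm]

/-! ### Invariance tested on polynomials -/

theorem continuous_polyMap (f : Fin n → MvPolynomial (Fin n) ℝ) : Continuous (polyMap f) :=
  continuous_pi fun i => MvPolynomial.continuous_eval (f i)

/-- The derivative `∑ᵢ ∂ᵢq(x) uᵢ` of the polynomial `q` at `x` in the direction `u`. -/
def polyFDeriv (q : MvPolynomial (Fin n) ℝ) (x : Fin n → ℝ) : (Fin n → ℝ) →L[ℝ] ℝ :=
  ∑ i, MvPolynomial.eval x (MvPolynomial.pderiv i q) • ContinuousLinearMap.proj i

theorem polyFDeriv_apply (q : MvPolynomial (Fin n) ℝ) (x u : Fin n → ℝ) :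
    polyFDeriv q x u = ∑ i, MvPolynomial.eval x (MvPolynomial.pderiv i q) * u i := by
  simp [polyFDeriv]

theorem hasFDerivAt_eval (q : MvPolynomial (Fin n) ℝ) (x : Fin n → ℝ) :
    HasFDerivAt (fun z => MvPolynomial.eval z q) (polyFDeriv q x) x := by
  induction q using MvPolynomial.induction_on with
  | C a =>
    have : polyFDeriv (MvPolynomial.C a) x = 0 := by ext u; simp [polyFDeriv_apply]
    simpa [this] using hasFDerivAt_const a x
  | add p q hp hq =>
    have : polyFDeriv (p + q) x = polyFDeriv p x + polyFDeriv q x := by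
      ext u; simp [polyFDeriv_apply, add_mul, Finset.sum_add_distrib]
    simpa [this] using hp.fun_add hq
  | mul_X p i hp =>
    have : polyFDeriv (p * MvPolynomial.X i) x = MvPolynomial.eval x p •
        (ContinuousLinearMap.proj i : (Fin n → ℝ) →L[ℝ] ℝ) + x i • polyFDeriv p x := by
      ext u
      have e : ∀ l, MvPolynomial.eval x (MvPolynomial.pderiv l (p * MvPolynomial.X i)) * u l =
          (if i = l then MvPolynomial.eval x p * u i else 0) +
            x i * (MvPolynomial.eval x (MvPolynomial.pderiv l p) * u l) := fun l => by
        rw [Derivation.leibniz, MvPolynomial.pderiv_X]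
        by_cases h : i = l
        · subst h; simp; ring
        · simp [h]; ring
      simp only [polyFDeriv_apply, e, Finset.sum_add_distrib, ← Finset.mul_sum]
      simp [polyFDeriv_apply]
    rw [this]
    simpa using hp.fun_mul (hasFDerivAt_apply i x)

theorem contDiff_eval (q : MvPolynomial (Fin n) ℝ) :
    ContDiff ℝ 1 fun x => MvPolynomial.eval x q := by
  induction q using MvPolynomial.induction_on with
  | C a => simpa using contDiff_const
  | add p q hp hq => simpa using hp.add hq
  | mul_X p i hp => simpa using hp.mul (contDiff_apply ℝ ℝ i)

theorem eval_invOp_discrete (f : Fin n → MvPolynomial (Fin n) ℝ) (q : MvPolynomial (Fin n) ℝ)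
    (x : Fin n → ℝ) : MvPolynomial.eval x (invOp .discrete f q) =
      MvPolynomial.eval (polyMap f x) q - MvPolynomial.eval x q := by
  simp only [invOp, map_sub, sub_left_inj]
  rw [← MvPolynomial.coe_aeval_eq_eval, ← MvPolynomial.coe_aeval_eq_eval]
  simp only [RingHom.coe_coe, MvPolynomial.aeval_bind₁]
  rfl

theorem eval_invOp_continuous (f : Fin n → MvPolynomial (Fin n) ℝ) (q : MvPolynomial (Fin n) ℝ)
    (x : Fin n → ℝ) :
    MvPolynomial.eval x (invOp .continuous f q) = polyFDeriv q x (polyMap f x) := by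
  simp [invOp, polyFDeriv_apply, polyMap]

/-- Invariant measures satisfy the invariance equations for polynomials. -/
theorem Invariant.integral_invOp {k : TimeKind} {f : Fin n → MvPolynomial (Fin n) ℝ}
    {μ : Measure (Fin n → ℝ)} [IsFiniteMeasure μ] {K : Set (Fin n → ℝ)} (hK : IsCompact K)
    (hμ : μ Kᶜ = 0) (h : Invariant k f μ) (q : MvPolynomial (Fin n) ℝ) :
    ∫ x, MvPolynomial.eval x (invOp k f q) ∂μ = 0 := by
  cases k with
  | discrete =>
    have h' : μ.map (polyMap f) = μ := h
    simp only [eval_invOp_discrete]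
    have hc := MvPolynomial.continuous_eval q
    have hcf : Continuous fun x => MvPolynomial.eval (polyMap f x) q :=
      hc.comp (continuous_polyMap f)
    rw [integral_sub (integrable_of_continuous hK hμ hcf)
      (integrable_of_continuous hK hμ hc), sub_eq_zero]
    conv_rhs => rw [← h']
    rw [integral_map (continuous_polyMap f).aemeasurable hc.aestronglyMeasurable]
  | continuous =>
    have := h _ (contDiff_eval q)
    simp only [eval_invOp_continuous]
    simpa only [(hasFDerivAt_eval q _).fderiv] using this

theorem map_eq_of_integral_invOp {f : Fin n → MvPolynomial (Fin n) ℝ}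
    {μ : Measure (Fin n → ℝ)} [IsFiniteMeasure μ] {K : Set (Fin n → ℝ)} (hK : IsCompact K)
    (hμ : μ Kᶜ = 0)
    (h : ∀ q, ∫ x, MvPolynomial.eval x (invOp .discrete f q) ∂μ = 0) :
    μ.map (polyMap f) = μ := by
  have hF := continuous_polyMap f
  have hK' : IsCompact (K ∪ polyMap f '' K) := hK.union (hK.image hF)
  refine measure_eq_of_polynomial hK' ?_ ?_ fun q => ?_
  · rw [Measure.map_apply hF.measurable hK'.isClosed.measurableSet.compl]
    have hsub : polyMap f ⁻¹' (K ∪ polyMap f '' K)ᶜ ⊆ Kᶜ := fun x hx hxK =>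
      hx (Or.inr ⟨x, hxK, rfl⟩)
    exact measure_mono_null hsub hμ
  · exact measure_mono_null (Set.compl_subset_compl.2 Set.subset_union_left) hμ
  · have hc := MvPolynomial.continuous_eval q
    have hcf : Continuous fun x => MvPolynomial.eval (polyMap f x) q := hc.comp hF
    have := h q
    simp only [eval_invOp_discrete] at this
    rw [integral_sub (integrable_of_continuous hK hμ hcf)
      (integrable_of_continuous hK hμ hc), sub_eq_zero] at this
    rw [integral_map hF.aemeasurable hc.aestronglyMeasurable]
    exact this

/-- The translate `x ↦ q (x - a)` of a polynomial. -/
def translate (a : Fin n → ℝ) (q : MvPolynomial (Fin n) ℝ) : MvPolynomial (Fin n) ℝ :=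
  MvPolynomial.bind₁ (fun i => MvPolynomial.X i - MvPolynomial.C (a i)) q

theorem eval_translate (a : Fin n → ℝ) (q : MvPolynomial (Fin n) ℝ) (x : Fin n → ℝ) :
    MvPolynomial.eval x (translate a q) = MvPolynomial.eval (x - a) q := by
  rw [translate, ← MvPolynomial.coe_aeval_eq_eval, ← MvPolynomial.coe_aeval_eq_eval]
  simp only [RingHom.coe_coe, MvPolynomial.aeval_bind₁]
  congr 2
  ext i
  simp

theorem polyFDeriv_translate (a : Fin n → ℝ) (q : MvPolynomial (Fin n) ℝ) (x : Fin n → ℝ) :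
    polyFDeriv (translate a q) x = polyFDeriv q (x - a) := by
  refine (hasFDerivAt_eval (translate a q) x).unique ?_
  simp only [eval_translate]
  exact (hasFDerivAt_eval q (x - a)).comp x ((hasFDerivAt_id x).sub_const a)

theorem continuous_polyFDeriv_apply (q : MvPolynomial (Fin n) ℝ) :
    Continuous fun z : (Fin n → ℝ) × (Fin n → ℝ) => polyFDeriv q z.1 z.2 := by
  simp only [polyFDeriv_apply]
  refine continuous_finsetSum _ fun i _ => ?_
  exact ((MvPolynomial.continuous_eval _).comp continuous_fst).mul
    ((continuous_apply i).comp continuous_snd)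

/-- For a polynomial `q` and a test function `w`, the function
`x ↦ ∫ q(x - y) Dw(y)(f x) dy` is the derivative along `f` of the polynomial `q ∗ w`, so that its
integral vanishes. It is evaluated by an integration by parts and Fubini's theorem, which reduce
the claim to the translates of `q`. -/
theorem integral_convolution_eq_zero {f : Fin n → MvPolynomial (Fin n) ℝ}
    {μ : Measure (Fin n → ℝ)} [IsFiniteMeasure μ] {K : Set (Fin n → ℝ)} (hK : IsCompact K)
    (hμ : μ Kᶜ = 0)
    (h : ∀ q, ∫ x, MvPolynomial.eval x (invOp .continuous f q) ∂μ = 0)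
    (q : MvPolynomial (Fin n) ℝ) {w : (Fin n → ℝ) → ℝ} (hw : ContDiff ℝ 1 w)
    (hws : HasCompactSupport w) :
    ∫ x, (∫ y, MvPolynomial.eval (x - y) q * fderiv ℝ w y (polyMap f x)) ∂μ = 0 := by
  have hDw : Continuous (fderiv ℝ w) := hw.continuous_fderiv one_ne_zero
  have hsub : ∀ x y : Fin n → ℝ,
      HasFDerivAt (fun y => MvPolynomial.eval (x - y) q) (-polyFDeriv q (x - y)) y := fun x y => by
    have h₁ := (hasFDerivAt_eval q (x - y)).comp y ((hasFDerivAt_id y).const_sub x)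
    have h₂ : (polyFDeriv q (x - y)).comp (-ContinuousLinearMap.id ℝ (Fin n → ℝ)) =
        -polyFDeriv q (x - y) := by ext u; simp
    rw [← h₂]
    exact h₁
  have hqc : ∀ x, Continuous fun y => MvPolynomial.eval (x - y) q := fun x =>
    (MvPolynomial.continuous_eval q).comp (continuous_const.sub continuous_id)
  have hPc : Continuous fun z : (Fin n → ℝ) × (Fin n → ℝ) =>
      polyFDeriv q (z.1 - z.2) (polyMap f z.1) * w z.2 :=
    ((continuous_polyFDeriv_apply q).comp ((continuous_fst.sub continuous_snd).prodMk
      ((continuous_polyMap f).comp continuous_fst))).mul (hw.continuous.comp continuous_snd)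
  have hparts : ∀ x, ∫ y, MvPolynomial.eval (x - y) q * fderiv ℝ w y (polyMap f x) =
      ∫ y in tsupport w, polyFDeriv q (x - y) (polyMap f x) * w y := by
    intro x
    have hfd : ∀ y, fderiv ℝ (fun y => MvPolynomial.eval (x - y) q) y (polyMap f x) * w y =
        -(polyFDeriv q (x - y) (polyMap f x) * w y) := fun y => by
      rw [(hsub x y).fderiv, neg_apply, neg_mul]
    have hcont : Continuous fun y => polyFDeriv q (x - y) (polyMap f x) * w y := by
      have h₁ := hPc.comp (Continuous.prodMk_right (X := Fin n → ℝ) (Y := Fin n → ℝ) x)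
      simpa only [Function.comp_def] using h₁
    have hDwx : Continuous fun y => fderiv ℝ w y (polyMap f x) := hDw.clm_apply continuous_const
    have hsupp : HasCompactSupport fun y => fderiv ℝ w y (polyMap f x) := hws.fderiv_apply ℝ _
    have i₁ : Integrable (fun y => fderiv ℝ (fun y => MvPolynomial.eval (x - y) q) y
        (polyMap f x) * w y) volume := by
      simp only [hfd]
      exact (hcont.integrable_of_hasCompactSupport hws.mul_left).neg
    have i₂ : Integrable (fun y => MvPolynomial.eval (x - y) q * fderiv ℝ w y (polyMap f x))
        volume :=
      ((hqc x).mul hDwx).integrable_of_hasCompactSupport hsupp.mul_left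
    have i₃ : Integrable (fun y => MvPolynomial.eval (x - y) q * w y) volume :=
      ((hqc x).mul hw.continuous).integrable_of_hasCompactSupport hws.mul_left
    rw [integral_mul_fderiv_eq_neg_fderiv_mul_of_integrable i₁ i₂ i₃
      (fun y _ => (hsub x y).differentiableAt) (fun y _ => hw.differentiable one_ne_zero y)]
    simp only [hfd, integral_neg, neg_neg]
    refine (setIntegral_eq_integral_of_forall_compl_eq_zero fun y hy => ?_).symm
    rw [image_eq_zero_of_notMem_tsupport hy, mul_zero]
  simp only [hparts]
  have hfin : IsFiniteMeasure ((volume : Measure (Fin n → ℝ)).restrict (tsupport w)) :=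
    ⟨by rw [Measure.restrict_apply_univ]; exact hws.measure_lt_top⟩
  have hmem : ∀ᵐ z ∂(μ.prod (volume.restrict (tsupport w))), z ∈ K ×ˢ tsupport w := by
    have h₁ : ∀ᵐ z ∂(μ.prod (volume.restrict (tsupport w))), z.1 ∈ K :=
      Measure.quasiMeasurePreserving_fst.ae (ae_mem_of_measure_compl hμ)
    have h₂ : ∀ᵐ z ∂(μ.prod (volume.restrict (tsupport w))), z.2 ∈ tsupport w :=
      Measure.quasiMeasurePreserving_snd.ae (ae_restrict_mem (isClosed_tsupport w).measurableSet)
    filter_upwards [h₁, h₂] with z hz₁ hz₂ using ⟨hz₁, hz₂⟩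
  rw [integral_integral_swap]
  · refine integral_eq_zero_of_ae (ae_of_all _ fun y => ?_)
    simp only [Pi.zero_apply]
    rw [integral_mul_const]
    have := h (translate y q)
    simp only [eval_invOp_continuous, polyFDeriv_translate] at this
    rw [this, zero_mul]
  · obtain ⟨C, hC⟩ := (hK.prod hws.isCompact).exists_bound_of_continuousOn hPc.continuousOn
    refine Integrable.of_bound hPc.aestronglyMeasurable C ?_
    filter_upwards [hmem] with z hz using hC z hz

/-- The polynomial `A - ‖x‖²`, whose powers, restricted to a ball and normalized, are the Landau
kernels. -/
def landau (n : ℕ) (A : ℝ) : MvPolynomial (Fin n) ℝ :=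
  MvPolynomial.C A - ∑ i, MvPolynomial.X i ^ 2

theorem eval_landau (A : ℝ) (x : Fin n → ℝ) :
    MvPolynomial.eval x (landau n A) = A - ∑ i, x i ^ 2 := by
  simp [landau]

/-- The divergence equation for compactly supported test functions: the integrals against Landau
kernels are integrals of derivatives of polynomials and converge pointwise and boundedly. -/
theorem integral_fderiv_eq_zero_of_hasCompactSupport {f : Fin n → MvPolynomial (Fin n) ℝ}
    {μ : Measure (Fin n → ℝ)} [IsFiniteMeasure μ] {K : Set (Fin n → ℝ)} (hK : IsCompact K)
    (hμ : μ Kᶜ = 0)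
    (h : ∀ q, ∫ x, MvPolynomial.eval x (invOp .continuous f q) ∂μ = 0)
    {w : (Fin n → ℝ) → ℝ} (hw : ContDiff ℝ 1 w) (hws : HasCompactSupport w) :
    ∫ x, fderiv ℝ w x (polyMap f x) ∂μ = 0 := by
  have hDw : Continuous (fderiv ℝ w) := hw.continuous_fderiv one_ne_zero
  have hDws : HasCompactSupport (fderiv ℝ w) := hws.fderiv ℝ
  -- `S` contains all the differences of points of `K` and of the support of `Dw`.
  obtain ⟨R, hR0, hRK⟩ := hK.isBounded.subset_closedBall_lt 0 0
  obtain ⟨R', hR0', hRw⟩ := hDws.isCompact.isBounded.subset_closedBall_lt 0 0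
  set S : Set (Fin n → ℝ) := Metric.closedBall 0 (R + R') with hS
  have hSc : IsCompact S := isCompact_closedBall _ _
  -- The summand `1` makes the kernel at least `1` on `S`, whatever the dimension.
  set A : ℝ := n * (R + R') ^ 2 + 1 with hA
  set c : (Fin n → ℝ) → ℝ := fun t => MvPolynomial.eval t (landau n A) with hcdef
  have hc : Continuous c := MvPolynomial.continuous_eval _
  have hc1 : ∀ t ∈ S, 1 ≤ c t := by
    intro t ht
    have : ∑ i, t i ^ 2 ≤ ∑ _i : Fin n, (R + R') ^ 2 := Finset.sum_le_sum fun i _ => by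
      have h₁ : ‖t i‖ ≤ R + R' := (norm_le_pi_norm t i).trans (by simpa [hS] using ht)
      rw [← sq_abs]
      exact pow_le_pow_left₀ (abs_nonneg _) h₁ 2
    simp only [Finset.sum_const, Finset.card_univ, Fintype.card_fin, nsmul_eq_mul] at this
    simp only [hcdef, eval_landau, hA]
    linarith
  have hmax : ∀ t ∈ S, t ≠ 0 → c t < c 0 := by
    intro t _ ht
    obtain ⟨i, hi⟩ := Function.ne_iff.1 ht
    have : 0 < ∑ i, t i ^ 2 := Finset.sum_pos' (fun i _ => sq_nonneg _)
      ⟨i, Finset.mem_univ i, by have : t i ≠ 0 := hi; positivity⟩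
    simp only [hcdef, eval_landau]
    simpa using this
  have h0S : (0 : Fin n → ℝ) ∈ interior S :=
    Metric.ball_subset_interior_closedBall (Metric.mem_ball_self (by positivity))
  have hc0 : 0 < c 0 := zero_lt_one.trans_le (hc1 0 (interior_subset h0S))
  have hgc : ∀ x, Continuous fun t => fderiv ℝ w (x - t) (polyMap f x) := fun x =>
    (hDw.comp (continuous_const.sub continuous_id)).clm_apply continuous_const
  set G : ℕ → (Fin n → ℝ) → ℝ := fun l x =>
    (∫ t in S, c t ^ l)⁻¹ • ∫ t in S, c t ^ l • fderiv ℝ w (x - t) (polyMap f x) with hG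
  have hlim : ∀ x, Tendsto (fun l => G l x) atTop (𝓝 (fderiv ℝ w x (polyMap f x))) := by
    intro x
    have := tendsto_setIntegral_pow_smul_of_unique_maximum_of_isCompact_of_continuousOn
      (μ := (volume : Measure (Fin n → ℝ))) hSc hc.continuousOn hmax
      (fun t ht => zero_le_one.trans (hc1 t ht)) hc0 (subset_closure h0S) (hgc x).continuousOn
    rw [sub_zero] at this
    exact this
  have hIpos : ∀ l, 0 < ∫ t in S, c t ^ l := by
    intro l
    rw [setIntegral_pos_iff_support_of_nonneg_ae]
    · refine (isOpen_interior.measure_pos volume ⟨0, h0S⟩).trans_le (measure_mono fun t ht => ?_)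
      exact ⟨(pow_pos (zero_lt_one.trans_le (hc1 t (interior_subset ht))) l).ne',
        interior_subset ht⟩
    · filter_upwards [ae_restrict_mem hSc.isClosed.measurableSet] with t ht
      exact pow_nonneg (zero_le_one.trans (hc1 t ht)) l
    · exact (hc.pow l).continuousOn.integrableOn_compact hSc
  -- On `K` the truncated convolution is the convolution with a polynomial.
  have hconv : ∀ l, ∀ x ∈ K, ∫ t in S, c t ^ l • fderiv ℝ w (x - t) (polyMap f x) =
      ∫ y, MvPolynomial.eval (x - y) (landau n A ^ l) * fderiv ℝ w y (polyMap f x) := by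
    intro l x hx
    rw [setIntegral_eq_integral_of_forall_compl_eq_zero]
    · rw [← integral_sub_left_eq_self _ volume x]
      simp [hcdef]
    · intro t ht
      have : fderiv ℝ w (x - t) = 0 := by
        refine image_eq_zero_of_notMem_tsupport fun hxt => ht ?_
        have h₁ := hRw hxt
        have h₂ := hRK hx
        rw [mem_closedBall_zero_iff] at h₁ h₂ ⊢
        calc ‖t‖ = ‖x - (x - t)‖ := by rw [sub_sub_cancel]
          _ ≤ R + R' := (norm_sub_le _ _).trans (add_le_add h₂ h₁)
      rw [this]; simp
  have hzero : ∀ l, ∫ x, G l x ∂μ = 0 := by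
    intro l
    simp only [hG, smul_eq_mul]
    rw [integral_const_mul]
    have := integral_convolution_eq_zero hK hμ h (landau n A ^ l) hw hws
    rw [← integral_congr_ae (f := fun x => ∫ t in S, c t ^ l • fderiv ℝ w (x - t) (polyMap f x))]
      at this
    · simp only [smul_eq_mul] at this
      rw [this, mul_zero]
    · filter_upwards [ae_mem_of_measure_compl hμ] with x hx using hconv l x hx
  obtain ⟨C, hC⟩ := hDw.bounded_above_of_compact_support hDws
  obtain ⟨B, hB⟩ := hK.exists_bound_of_continuousOn (continuous_polyMap f).continuousOn
  have hbound : ∀ l, ∀ x ∈ K, ‖G l x‖ ≤ C * B := by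
    intro l x hx
    have hC0 : 0 ≤ C := (norm_nonneg _).trans (hC 0)
    have h₁ : ‖∫ t in S, c t ^ l • fderiv ℝ w (x - t) (polyMap f x)‖ ≤
        ∫ t in S, c t ^ l * (C * B) := by
      refine norm_integral_le_of_norm_le
        (((hc.pow l).mul continuous_const).continuousOn.integrableOn_compact hSc) ?_
      filter_upwards [ae_restrict_mem hSc.isClosed.measurableSet] with t ht
      have hp : 0 ≤ c t ^ l := pow_nonneg (zero_le_one.trans (hc1 t ht)) l
      rw [norm_smul, Real.norm_of_nonneg hp]
      refine mul_le_mul_of_nonneg_left (((fderiv ℝ w (x - t)).le_opNorm _).trans ?_) hp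
      exact mul_le_mul (hC _) (hB x hx) (norm_nonneg _) hC0
    rw [integral_mul_const] at h₁
    simp only [hG]
    rw [norm_smul, norm_inv, Real.norm_of_nonneg (hIpos l).le, inv_mul_le_iff₀ (hIpos l)]
    exact h₁
  have hmeas : ∀ l, AEStronglyMeasurable (G l) μ := by
    intro l
    have : Continuous fun z : (Fin n → ℝ) × (Fin n → ℝ) =>
        c z.2 ^ l • fderiv ℝ w (z.1 - z.2) (polyMap f z.1) :=
      ((hc.comp continuous_snd).pow l).smul
        ((hDw.comp (continuous_fst.sub continuous_snd)).clm_apply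
          ((continuous_polyMap f).comp continuous_fst))
    have hm : StronglyMeasurable fun x =>
        ∫ t in S, c t ^ l • fderiv ℝ w (x - t) (polyMap f x) :=
      this.stronglyMeasurable.integral_prod_right'
    exact (hm.const_smul (∫ t in S, c t ^ l)⁻¹).aestronglyMeasurable
  have := tendsto_integral_of_dominated_convergence (μ := μ) (F := G) (fun _ => C * B) hmeas
    (integrable_const _) (fun l => by
      filter_upwards [ae_mem_of_measure_compl hμ] with x hx using hbound l x hx)
    (ae_of_all _ hlim)
  simp only [hzero] at this
  exact (tendsto_nhds_unique this tendsto_const_nhds)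

/-- Measures on a compact set that satisfy the invariance equations for polynomials are
invariant. -/
theorem invariant_of_integral_invOp {k : TimeKind} {f : Fin n → MvPolynomial (Fin n) ℝ}
    {μ : Measure (Fin n → ℝ)} [IsFiniteMeasure μ] {K : Set (Fin n → ℝ)} (hK : IsCompact K)
    (hμ : μ Kᶜ = 0) (h : ∀ q, ∫ x, MvPolynomial.eval x (invOp k f q) ∂μ = 0) :
    Invariant k f μ := by
  cases k with
  | discrete => exact map_eq_of_integral_invOp hK hμ h
  | continuous =>
    intro v hv
    -- A cutoff equal to `1` near `K` makes the test function compactly supported.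
    obtain ⟨R, hR0, hRK⟩ := hK.isBounded.subset_closedBall_lt 0 0
    let χ : ContDiffBump (0 : Fin n → ℝ) := ⟨R + 1, R + 2, by positivity, by linarith⟩
    have hχv : ContDiff ℝ 1 fun x => χ x * v x := χ.contDiff.mul hv
    rw [← integral_fderiv_eq_zero_of_hasCompactSupport hK hμ h hχv
      χ.hasCompactSupport.mul_right]
    refine integral_congr_ae ?_
    filter_upwards [ae_mem_of_measure_compl hμ] with x hx
    have hx' : x ∈ Metric.ball (0 : Fin n → ℝ) (R + 1) :=
      Metric.closedBall_subset_ball (by linarith) (hRK hx)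
    have : (fun x => χ x * v x) =ᶠ[𝓝 x] v := by
      filter_upwards [Metric.isOpen_ball.mem_nhds hx'] with z hz
      rw [χ.one_of_mem_closedBall (Metric.ball_subset_closedBall hz), one_mul]
    rw [this.fderiv_eq]

/-! ### Feasible measures give feasible moment sequences -/

theorem isCompact_semialgSet {g : Fin m → MvPolynomial (Fin n) ℝ} (hg : Archimedean g) :
    IsCompact (semialgSet g) := by
  have hclosed : IsClosed (semialgSet g) := by
    simp only [semialgSet, Set.ofPred_forall]
    exact isClosed_iInter fun j => isClosed_le continuous_const (MvPolynomial.continuous_eval _)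
  obtain ⟨j, N, hj⟩ := hg
  refine (isCompact_closedBall (0 : Fin n → ℝ) √N).of_isClosed_subset hclosed fun x hx => ?_
  have h : 0 ≤ MvPolynomial.eval x (g j) := hx j
  rw [hj] at h
  simp only [map_sub, MvPolynomial.eval_C, map_sum, map_pow, MvPolynomial.eval_X,
    sub_nonneg] at h
  rw [mem_closedBall_zero_iff, pi_norm_le_iff_of_nonneg (Real.sqrt_nonneg _)]
  intro i
  refine Real.abs_le_sqrt (le_trans ?_ h)
  exact Finset.single_le_sum (f := fun i => x i ^ 2) (fun i _ => sq_nonneg _) (Finset.mem_univ i)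

theorem leb_compl {X : Set (Fin n → ℝ)} (hX : IsCompact X) : leb X Xᶜ = 0 := by
  rw [leb, Measure.restrict_apply hX.isClosed.measurableSet.compl]
  simp

theorem isFiniteMeasure_leb {X : Set (Fin n → ℝ)} (hX : IsCompact X) : IsFiniteMeasure (leb X) :=
  ⟨by rw [leb, Measure.restrict_apply_univ]; exact hX.measure_lt_top⟩

theorem InLp.compl {X : Set (Fin n → ℝ)} (hX : IsCompact X) {p : ℝ≥0∞}
    {μ : Measure (Fin n → ℝ)} (h : InLp X p μ) : μ Xᶜ = 0 :=
  h.2.1 (leb_compl hX)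

theorem real_eq_univ {X : Set (Fin n → ℝ)} {μ : Measure (Fin n → ℝ)} (h : μ Xᶜ = 0) :
    μ.real X = μ.real Set.univ := by
  simp only [Measure.real]
  rw [measure_of_measure_compl_eq_zero h]

theorem density_nonneg (X : Set (Fin n → ℝ)) (μ : Measure (Fin n → ℝ)) (x : Fin n → ℝ) :
    0 ≤ density X μ x := ENNReal.toReal_nonneg

theorem haveLebesgueDecomposition_leb {X : Set (Fin n → ℝ)} (hX : IsCompact X)
    (μ : Measure (Fin n → ℝ)) [hμ : IsFiniteMeasure μ] : μ.HaveLebesgueDecomposition (leb X) := by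
  have h₁ : SigmaFinite μ := IsFiniteMeasure.toSigmaFinite μ
  have h₂ : SigmaFinite (leb X) :=
    @IsFiniteMeasure.toSigmaFinite _ _ (leb X) (isFiniteMeasure_leb hX)
  exact Measure.haveLebesgueDecomposition_of_sigmaFinite μ (leb X)

theorem integral_density_mul {X : Set (Fin n → ℝ)} (hX : IsCompact X) {p : ℝ≥0∞}
    {μ : Measure (Fin n → ℝ)} (h : InLp X p μ) (φ : (Fin n → ℝ) → ℝ) :
    ∫ x, density X μ x * φ x ∂(leb X) = ∫ x, φ x ∂μ := by
  have hfin : IsFiniteMeasure μ := h.1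
  have := haveLebesgueDecomposition_leb hX μ
  exact integral_rnDeriv_smul h.2.1

/-- Moments of measures feasible for the conic problem satisfy all the semidefinite constraints. -/
theorem ConicFeasible.psdConstraints {k : TimeKind} {f : Fin n → MvPolynomial (Fin n) ℝ}
    {g : Fin m → MvPolynomial (Fin n) ℝ} (hg : Archimedean g) {p : ℝ≥0∞}
    {μ : Measure (Fin n → ℝ)} (h : ConicFeasible k f (semialgSet g) p μ) (r : ℕ) :
    PsdConstraints g p r (moment μ) := by
  have hX := isCompact_semialgSet hg
  obtain ⟨-, hle, hLp⟩ := h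
  have := hLp.1
  have := isFiniteMeasure_leb hX
  have hμ := hLp.compl hX
  set X := semialgSet g with hXdef
  have hz : ∀ q, riesz (moment (leb X)) q = ∫ x, MvPolynomial.eval x q ∂(leb X) :=
    riesz_moment hX (leb_compl hX)
  have hy : ∀ q, riesz (moment μ) q = ∫ x, MvPolynomial.eval x q ∂μ := riesz_moment hX hμ
  rw [psdConstraints_iff]
  refine ⟨fun hp q _ t => ?_, fun hp q _ => ?_, fun q _ => ?_, fun j q _ => ?_⟩
  · subst hp
    have hq := memLp_of_continuous hX (leb_compl hX) (MvPolynomial.continuous_eval q) 2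
    -- The quadratic polynomial in `t` is bounded below by `‖q + t h‖²`, where `h` is the density.
    set Q := hq.toLp with hQ
    set H := hLp.2.2.toLp with hH
    have hHn : ‖H‖ ≤ 1 := by
      rw [hH, Lp.norm_toLp]
      exact ENNReal.toReal_le_of_le_ofReal zero_le_one (hle.trans_eq ENNReal.ofReal_one.symm)
    have e₁ : ∫ x, MvPolynomial.eval x (q * q) ∂(leb X) = ‖Q‖ ^ 2 := by
      rw [← real_inner_self_eq_norm_sq, L2.inner_def]
      refine integral_congr_ae ?_
      filter_upwards [hq.coeFn_toLp] with x hx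
      rw [hQ, hx]; simp [sq]
    have e₂ : ∫ x, MvPolynomial.eval x q ∂μ = inner ℝ Q H := by
      rw [← integral_density_mul hX hLp, L2.inner_def]
      refine integral_congr_ae ?_
      filter_upwards [hq.coeFn_toLp, hLp.2.2.coeFn_toLp] with x h₁ h₂
      rw [hQ, hH, h₁, h₂]; simp
    rw [hz, hy, e₁, e₂]
    have h₁ := norm_add_sq_real Q (t • H)
    rw [inner_smul_right, norm_smul, mul_pow, Real.norm_eq_abs, sq_abs] at h₁
    have h₂ : ‖H‖ ^ 2 ≤ 1 := pow_le_one₀ (norm_nonneg _) hHn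
    have h₃ := mul_le_mul_of_nonneg_left h₂ (sq_nonneg t)
    have h₄ := sq_nonneg ‖Q + t • H‖
    linarith
  · subst hp
    rw [hz, hy, ← integral_density_mul hX hLp]
    have hq := MvPolynomial.continuous_eval (q * q)
    have hb : ∀ᵐ x ∂(leb X), density X μ x ≤ 1 := by
      have h₁ : eLpNormEssSup (density X μ) (leb X) ≤ 1 := by
        rw [← eLpNorm_exponent_top]; exact hle
      filter_upwards [enorm_ae_le_eLpNormEssSup (density X μ) (leb X)] with x hx
      have := hx.trans h₁
      rw [Real.enorm_of_nonneg (density_nonneg _ _ _)] at this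
      simpa using this
    refine integral_mono_of_nonneg (ae_of_all _ fun x => ?_)
      (integrable_of_continuous hX (leb_compl hX) hq) ?_
    · have := density_nonneg X μ x
      simp only [Pi.zero_apply, map_mul]
      exact mul_nonneg this (mul_self_nonneg _)
    · filter_upwards [hb] with x hx
      rw [map_mul]
      exact mul_le_of_le_one_left (mul_self_nonneg _) hx
  · rw [hy]
    exact integral_nonneg fun x => by rw [map_mul]; exact mul_self_nonneg _
  · rw [hy]
    refine integral_nonneg_of_ae ?_
    filter_upwards [ae_mem_of_measure_compl hμ] with x hx
    rw [map_mul, map_mul]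
    exact mul_nonneg (hx j) (mul_self_nonneg _)

/-- The degree bound built into the semidefinite programs. -/
theorem totalDegree_invOp_le (k : TimeKind) (f : Fin n → MvPolynomial (Fin n) ℝ) {r : ℕ}
    (hr : 1 ≤ r) {α : Fin n →₀ ℕ} (hα : α.degree ≤ 2 * r) :
    (invOp k f (MvPolynomial.monomial α 1)).totalDegree ≤ sdpDegree f r := by
  set D := max 1 (mapDegree f) with hD
  have hD1 : 1 ≤ D := le_max_left _ _
  have hf : ∀ i, (f i).totalDegree ≤ D := fun i =>
    (Finset.le_sup (f := fun i => (f i).totalDegree) (Finset.mem_univ i)).trans (le_max_right _ _)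
  have hdeg : sdpDegree f r = 2 * r * D := rfl
  rw [hdeg]
  have h2r : 2 * r ≤ 2 * r * D := Nat.le_mul_of_pos_right _ hD1
  cases k with
  | discrete =>
    refine (MvPolynomial.totalDegree_sub _ _).trans (max_le ?_ ?_)
    · rw [MvPolynomial.bind₁_monomial, map_one, one_mul]
      refine (MvPolynomial.totalDegree_finsetProd _ _).trans ?_
      calc ∑ i ∈ α.support, (f i ^ α i).totalDegree ≤ ∑ i ∈ α.support, α i * D :=
            Finset.sum_le_sum fun i _ =>
              (MvPolynomial.totalDegree_pow _ _).trans (Nat.mul_le_mul_left _ (hf i))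
        _ = α.degree * D := by rw [← Finset.sum_mul, Finsupp.degree_apply]
        _ ≤ 2 * r * D := Nat.mul_le_mul_right _ hα
    · exact (totalDegree_monomial_le' hα).trans h2r
  | continuous =>
    refine MvPolynomial.totalDegree_finsetSum_le fun i _ => ?_
    rw [MvPolynomial.pderiv_monomial]
    by_cases hi : α i = 0
    · simp [hi]
    have hle : Finsupp.single i 1 ≤ α := by rw [Finsupp.single_le_iff]; omega
    have hdeg' : (α - Finsupp.single i 1).degree + 1 = α.degree := by
      have := congrArg Finsupp.degree (tsub_add_cancel_of_le hle)
      rwa [map_add, Finsupp.degree_single] at this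
    have h₁ : (MvPolynomial.monomial (α - Finsupp.single i 1) (1 * (α i : ℝ))).totalDegree ≤
        2 * r - 1 := (MvPolynomial.totalDegree_monomial_le _ _).trans
          (show (α - Finsupp.single i 1).degree ≤ _ by omega)
    refine (MvPolynomial.totalDegree_mul _ _).trans ((add_le_add h₁ (hf i)).trans ?_)
    obtain ⟨s, hs⟩ : ∃ s, 2 * r = s + 1 := ⟨2 * r - 1, by omega⟩
    rw [hs, add_tsub_cancel_right, add_mul, one_mul]
    exact Nat.add_le_add_right (Nat.le_mul_of_pos_right _ hD1) _

/-- Truncated moment sequences of measures feasible for the conic problem are feasible for the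
semidefinite programs. -/
theorem ConicFeasible.sdpFeasible {k : TimeKind} {f : Fin n → MvPolynomial (Fin n) ℝ}
    {g : Fin m → MvPolynomial (Fin n) ℝ} (hg : Archimedean g) {p : ℝ≥0∞}
    {μ : Measure (Fin n → ℝ)} (h : ConicFeasible k f (semialgSet g) p μ) {r : ℕ}
    (hr : rMin g ≤ r) :
    SdpFeasible k f g p r fun β => moment μ β.1 := by
  have hX := isCompact_semialgSet hg
  have := h.2.2.1
  have hμ := h.2.2.compl hX
  have hr1 : 1 ≤ r := (le_max_left _ _).trans hr
  have hext : ∀ α : Fin n →₀ ℕ, α.degree ≤ sdpDegree f r →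
      moment μ α = zeroExt (fun β : Expo n (sdpDegree f r) => moment μ β.1) α := fun α hα => by
    rw [zeroExt_of_le _ hα]
  refine ⟨fun α hα => ?_, (h.psdConstraints hg r).congr hr fun α hα => hext α ?_⟩
  · rw [invFunctional_eq_riesz, ← riesz_congr (totalDegree_invOp_le k f hr1 hα) hext,
      riesz_moment hX hμ]
    exact h.1.integral_invOp hX hμ _
  · exact hα.trans (Nat.le_mul_of_pos_right _ (Nat.succ_le_iff.1 (le_max_left _ _)))

/-! ### Sequences feasible at all orders are moment sequences of feasible measures -/

theorem invOp_add (k : TimeKind) (f : Fin n → MvPolynomial (Fin n) ℝ)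
    (p q : MvPolynomial (Fin n) ℝ) : invOp k f (p + q) = invOp k f p + invOp k f q := by
  cases k
  · simp only [invOp, map_add]; ring
  · simp only [invOp, map_add, add_mul, Finset.sum_add_distrib]

theorem invOp_smul (k : TimeKind) (f : Fin n → MvPolynomial (Fin n) ℝ) (c : ℝ)
    (p : MvPolynomial (Fin n) ℝ) : invOp k f (c • p) = c • invOp k f p := by
  cases k
  · simp only [invOp, map_smul, smul_sub]
  · simp only [invOp, Derivation.map_smul, smul_mul_assoc, Finset.smul_sum]

theorem riesz_invOp_eq_zero {k : TimeKind} {f : Fin n → MvPolynomial (Fin n) ℝ}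
    {y : (Fin n →₀ ℕ) → ℝ} (h : ∀ α, riesz y (invOp k f (MvPolynomial.monomial α 1)) = 0)
    (q : MvPolynomial (Fin n) ℝ) : riesz y (invOp k f q) = 0 := by
  induction q using MvPolynomial.induction_on' with
  | monomial α a =>
    have : MvPolynomial.monomial α a = a • MvPolynomial.monomial α (1 : ℝ) := by
      rw [MvPolynomial.smul_monomial, smul_eq_mul, mul_one]
    rw [this, invOp_smul, riesz_smul, h, mul_zero]
  | add p q hp hq => rw [invOp_add, riesz_add, hp, hq, add_zero]

/-- A sequence satisfying the constraints of all orders defines a functional dominated by the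
`L²` norm. For `p = ∞` this uses `ℓ_y(q)² ≤ y₀ ℓ_y(q²)` and `ℓ_y(q²) ≤ ℓ_z(q²)`. -/
theorem exists_riesz_sq_le {g : Fin m → MvPolynomial (Fin n) ℝ} {p : ℝ≥0∞}
    {y : (Fin n →₀ ℕ) → ℝ} (hp : p = 2 ∨ p = ∞) (hy : ∀ r, rMin g ≤ r → PsdConstraints g p r y) :
    ∃ C : ℝ, 0 ≤ C ∧ (p = 2 → C = 1) ∧ ∀ q : MvPolynomial (Fin n) ℝ,
      riesz y q ^ 2 ≤ C ^ 2 * riesz (moment (leb (semialgSet g))) (q * q) := by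
  have hy' := fun q : MvPolynomial (Fin n) ℝ =>
    (psdConstraints_iff g p _ y).1 (hy (max (rMin g) q.totalDegree) (le_max_left _ _))
  by_cases h2 : p = 2
  · refine ⟨1, zero_le_one, fun _ => rfl, fun q => ?_⟩
    -- The minimum of the quadratic polynomial in `t` is attained at `t = -ℓ_y(q)`.
    have := (hy' q).1 h2 q (le_max_right _ _) (-riesz y q)
    nlinarith
  · have hI : p = ∞ := hp.resolve_left h2
    have h0 : riesz y (1 * 1) = y 0 := by
      have := riesz_monomial y 0 1
      rw [one_mul] at this
      rw [one_mul]
      exact this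
    have hy0 : 0 ≤ y 0 := by
      rw [← h0]
      exact (hy' 1).2.2.1 1 (le_max_right _ _)
    refine ⟨√(y 0), Real.sqrt_nonneg _, fun h => absurd h h2, fun q => ?_⟩
    rw [Real.sq_sqrt hy0]
    have hd := discrim_le_zero (a := y 0) (b := 2 * riesz y q) (c := riesz y (q * q)) fun t => by
      have := (hy' q).2.2.1 (q + t • 1) ((MvPolynomial.totalDegree_add _ _).trans (max_le
        (le_max_right _ _) ((MvPolynomial.totalDegree_smul_le _ _).trans (by simp))))
      rw [riesz_sq_add, h0, mul_one] at this
      linarith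
    have h₁ := (hy' q).2.1 hI q (le_max_right _ _)
    have h₂ := mul_le_mul_of_nonneg_left h₁ hy0
    rw [discrim] at hd
    linarith

/-- The measure with density `u ≥ 0` in `L^p` belongs to `L^p_+(X)`, its norm is that of `u`, and
integrals against it are integrals against `u λ`. -/
theorem inLp_withDensity {X : Set (Fin n → ℝ)} (hX : IsCompact X) {u : (Fin n → ℝ) → ℝ}
    {p : ℝ≥0∞} (hp1 : 1 ≤ p) (hu : MemLp u p (leb X)) (hu0 : 0 ≤ᵐ[leb X] u) :
    InLp X p ((leb X).withDensity fun x => ENNReal.ofReal (u x)) ∧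
      lpNorm X p ((leb X).withDensity fun x => ENNReal.ofReal (u x)) = eLpNorm u p (leb X) ∧
      ∀ φ : (Fin n → ℝ) → ℝ, ∫ x, φ x ∂((leb X).withDensity fun x => ENNReal.ofReal (u x)) =
        ∫ x, u x * φ x ∂(leb X) := by
  have := isFiniteMeasure_leb hX
  have hint : Integrable u (leb X) := hu.integrable hp1
  have hm : AEMeasurable (fun x => ENNReal.ofReal (u x)) (leb X) :=
    hu.aestronglyMeasurable.aemeasurable.ennreal_ofReal
  have hd : density X ((leb X).withDensity fun x => ENNReal.ofReal (u x)) =ᵐ[leb X] u := by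
    filter_upwards [Measure.rnDeriv_withDensity₀ (leb X) hm, hu0] with x hx h0
    rw [density, hx, ENNReal.toReal_ofReal h0]
  refine ⟨⟨isFiniteMeasure_withDensity_ofReal hint.2, withDensity_absolutelyContinuous _ _, ?_⟩,
    eLpNorm_congr_ae hd, fun φ => ?_⟩
  · exact (memLp_congr_ae hd).2 hu
  · rw [integral_withDensity_eq_integral_toReal_smul₀ hm
      (ae_of_all _ fun _ => ENNReal.ofReal_lt_top)]
    refine integral_congr_ae ?_
    filter_upwards [hu0] with x hx
    rw [ENNReal.toReal_ofReal hx, smul_eq_mul]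

/-- The solution of the moment problem: the domination by Lebesgue moments provides a density in
`L²`, and the constraints on squares confine it to `[0, ∞)`, and to `[0, 1]` if `p = ∞`. The
localizing constraints are not needed for this, since the density lives on `X`. -/
theorem exists_conicFeasible_of_psdConstraints {k : TimeKind}
    {f : Fin n → MvPolynomial (Fin n) ℝ} {g : Fin m → MvPolynomial (Fin n) ℝ}
    (hg : Archimedean g) {p : ℝ≥0∞} (hp : p = 2 ∨ p = ∞) {y : (Fin n →₀ ℕ) → ℝ}
    (hy : ∀ r, rMin g ≤ r → PsdConstraints g p r y)
    (hinv : ∀ α, riesz y (invOp k f (MvPolynomial.monomial α 1)) = 0) :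
    ∃ μ, ConicFeasible k f (semialgSet g) p μ ∧ y = moment μ := by
  have hX := isCompact_semialgSet hg
  have := isFiniteMeasure_leb hX
  set X := semialgSet g with hXdef
  have hc := leb_compl hX
  have hz : ∀ q, riesz (moment (leb X)) q = ∫ x, MvPolynomial.eval x q ∂(leb X) :=
    riesz_moment hX hc
  have hy' := fun q : MvPolynomial (Fin n) ℝ =>
    (psdConstraints_iff g p _ y).1 (hy (max (rMin g) q.totalDegree) (le_max_left _ _))
  obtain ⟨C, hC0, hC2, hC⟩ := exists_riesz_sq_le hp hy
  obtain ⟨u, hu, hun, hrep⟩ := exists_density_of_riesz_sq_le hX hc hC0 fun q => by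
    rw [← hz]; exact hC q
  have hu0 : 0 ≤ᵐ[leb X] u := ae_nonneg_of_polynomial hX hc hu fun q => by
    rw [← hrep]; exact (hy' q).2.2.1 q (le_max_right _ _)
  obtain ⟨hup, hun'⟩ : MemLp u p (leb X) ∧ eLpNorm u p (leb X) ≤ 1 := by
    by_cases h2 : p = 2
    · subst h2
      refine ⟨hu, ?_⟩
      rwa [hC2 rfl, ENNReal.ofReal_one] at hun
    · have hI : p = ∞ := hp.resolve_left h2
      have hone : MemLp (fun _ : Fin n → ℝ => (1 : ℝ)) 2 (leb X) := memLp_const 1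
      have hui : ∀ q : MvPolynomial (Fin n) ℝ,
          Integrable (fun x => u x * MvPolynomial.eval x (q * q)) (leb X) := fun q =>
        hu.integrable_mul (memLp_of_continuous hX hc (MvPolynomial.continuous_eval (q * q)) 2)
      have h1 : 0 ≤ᵐ[leb X] fun x => 1 - u x :=
        ae_nonneg_of_polynomial hX hc (hone.sub hu) fun q => by
          have h₁ := (hy' q).2.1 hI q (le_max_right _ _)
          rw [hz, hrep, ← sub_nonneg, ← integral_sub
            (integrable_of_continuous hX hc (MvPolynomial.continuous_eval (q * q))) (hui q)] at h₁
          refine h₁.trans_eq (integral_congr_ae (ae_of_all _ fun x => ?_))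
          simp only
          ring
      have hb : ∀ᵐ x ∂(leb X), ‖u x‖ ≤ 1 := by
        filter_upwards [hu0, h1] with x h₁ h₂
        simp only [Pi.zero_apply] at h₁ h₂
        rw [Real.norm_of_nonneg h₁]
        linarith
      subst hI
      refine ⟨memLp_top_of_bound hu.aestronglyMeasurable 1 hb, ?_⟩
      rw [eLpNorm_exponent_top]
      simpa using eLpNormEssSup_le_of_ae_bound hb
  have hp1 : 1 ≤ p := by rcases hp with rfl | rfl <;> norm_num
  obtain ⟨hLp, hnorm, hφ⟩ := inLp_withDensity hX hp1 hup hu0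
  have hrep' : ∀ q, riesz y q = ∫ x, MvPolynomial.eval x q
      ∂((leb X).withDensity fun x => ENNReal.ofReal (u x)) := fun q => by rw [hφ, hrep]
  have := hLp.1
  refine ⟨_, ⟨invariant_of_integral_invOp hX (hLp.compl hX) fun q => ?_, ?_, hLp⟩, ?_⟩
  · rw [← hrep']; exact riesz_invOp_eq_zero hinv q
  · rw [hnorm]; exact hun'
  · ext α
    have := hrep' (MvPolynomial.monomial α 1)
    rw [riesz_monomial, one_mul] at this
    rw [this]
    simp only [eval_monomial_one, moment]

/-! ### The conic problem -/

open scoped NNReal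

theorem density_smul {X : Set (Fin n → ℝ)} (hX : IsCompact X) (μ : Measure (Fin n → ℝ))
    [IsFiniteMeasure μ] (a : ℝ≥0) :
    density X (a • μ) =ᵐ[leb X] (a : ℝ) • density X μ := by
  have := haveLebesgueDecomposition_leb hX μ
  have := isFiniteMeasure_leb hX
  filter_upwards [Measure.rnDeriv_smul_left μ (leb X) a] with x hx
  rw [density, hx, Pi.smul_apply, Pi.smul_apply, ENNReal.smul_def, smul_eq_mul, smul_eq_mul,
    ENNReal.toReal_mul, ENNReal.coe_toReal, density]

theorem InLp.smul {X : Set (Fin n → ℝ)} (hX : IsCompact X) {p : ℝ≥0∞}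
    {μ : Measure (Fin n → ℝ)} (h : InLp X p μ) (a : ℝ≥0) : InLp X p (a • μ) := by
  have hfin : IsFiniteMeasure μ := h.1
  exact ⟨inferInstance, h.2.1.smul_left a,
    (memLp_congr_ae (density_smul hX μ a)).2 (h.2.2.const_smul _)⟩

theorem lpNorm_smul {X : Set (Fin n → ℝ)} (hX : IsCompact X) (p : ℝ≥0∞)
    (μ : Measure (Fin n → ℝ)) [IsFiniteMeasure μ] (a : ℝ≥0) :
    lpNorm X p (a • μ) = a * lpNorm X p μ := by
  have ha : ‖(a : ℝ)‖ₑ = a := by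
    rw [Real.enorm_of_nonneg (NNReal.coe_nonneg a), ENNReal.ofReal_coe_nnreal]
  rw [lpNorm, eLpNorm_congr_ae (density_smul hX μ a), eLpNorm_const_smul, lpNorm, ha]

theorem Invariant.smul {k : TimeKind} {f : Fin n → MvPolynomial (Fin n) ℝ}
    {μ : Measure (Fin n → ℝ)} (h : Invariant k f μ) (a : ℝ≥0) : Invariant k f (a • μ) := by
  cases k with
  | discrete =>
    have h' : μ.map (polyMap f) = μ := h
    change (a • μ).map (polyMap f) = a • μ
    rw [Measure.map_smul, h']
  | continuous =>
    intro v hv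
    rw [integral_smul_nnreal_measure, h v hv, smul_zero]

/-- The `L¹` norm of a measure is its mass. -/
theorem lpNorm_one_eq {X : Set (Fin n → ℝ)} (hX : IsCompact X) {p : ℝ≥0∞}
    {μ : Measure (Fin n → ℝ)} (h : InLp X p μ) : lpNorm X 1 μ = μ Set.univ := by
  have hfin : IsFiniteMeasure μ := h.1
  have := haveLebesgueDecomposition_leb hX μ
  have hfin' := isFiniteMeasure_leb hX
  have hσ : SigmaFinite μ := IsFiniteMeasure.toSigmaFinite μ
  rw [lpNorm, eLpNorm_one_eq_lintegral_enorm]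
  conv_rhs => rw [← Measure.withDensity_rnDeriv_eq μ (leb X) h.2.1]
  rw [withDensity_apply _ MeasurableSet.univ, Measure.restrict_univ]
  refine lintegral_congr_ae ?_
  filter_upwards [Measure.rnDeriv_lt_top μ (leb X)] with x hx
  rw [Real.enorm_of_nonneg (density_nonneg X μ x), density, ENNReal.ofReal_toReal hx.ne]

theorem lpNorm_ne_zero {X : Set (Fin n → ℝ)} (hX : IsCompact X) {p : ℝ≥0∞} (hp : p ≠ 0)
    {μ : Measure (Fin n → ℝ)} (h : InLp X p μ) (hμ : μ Set.univ ≠ 0) : lpNorm X p μ ≠ 0 := by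
  intro h0
  rw [lpNorm, eLpNorm_eq_zero_iff h.2.2.aestronglyMeasurable hp] at h0
  refine hμ ?_
  rw [← lpNorm_one_eq hX h, lpNorm, eLpNorm_congr_ae h0, eLpNorm_zero]

/-- If the invariant probability measure with density in `L^p` is unique, then all invariant
measures with density in `L^p` are multiples of it. -/
theorem eq_smul_of_invariant {k : TimeKind} {f : Fin n → MvPolynomial (Fin n) ℝ}
    {X : Set (Fin n → ℝ)} (hX : IsCompact X) {p : ℝ≥0∞} {μ₀ ν : Measure (Fin n → ℝ)}
    (huniq : ∀ μ : Measure (Fin n → ℝ),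
      IsProbabilityMeasure μ ∧ InLp X p μ ∧ Invariant k f μ → μ = μ₀)
    (hν : InLp X p ν) (hinv : Invariant k f ν) : ν = (ν Set.univ).toNNReal • μ₀ := by
  have hfin : IsFiniteMeasure ν := hν.1
  set b := (ν Set.univ).toNNReal with hb
  have hbν : (b : ℝ≥0∞) = ν Set.univ := ENNReal.coe_toNNReal (measure_ne_top _ _)
  by_cases h0 : b = 0
  · rw [h0, ENNReal.coe_zero] at hbν
    rw [h0, zero_smul, Measure.measure_univ_eq_zero.1 hbν.symm]
  · have : b⁻¹ • ν = μ₀ := huniq _ ⟨⟨by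
      rw [Measure.smul_apply, ENNReal.smul_def, smul_eq_mul, ← hbν, ← ENNReal.coe_mul,
        inv_mul_cancel₀ h0, ENNReal.coe_one]⟩, hν.smul hX _, hinv.smul _⟩
    rw [← this, smul_smul, mul_inv_cancel₀ h0, one_smul]

/-- The conic problem has a unique solution, of positive mass. -/
theorem exists_unique_conicOptimal {k : TimeKind} {f : Fin n → MvPolynomial (Fin n) ℝ}
    {X : Set (Fin n → ℝ)} (hX : IsCompact X) {p : ℝ≥0∞} (hp : p ≠ 0)
    (hinv : UniqueInvariantDensity k f X p) :
    ∃ μ, ConicOptimal k f X p μ ∧ ∀ ν, ConicOptimal k f X p ν → ν = μ := by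
  obtain ⟨μ₀, ⟨hprob, hLp, hI⟩, huniq⟩ := hinv
  have hc0 := lpNorm_ne_zero hX hp hLp (by rw [measure_univ]; exact one_ne_zero)
  have hct : lpNorm X p μ₀ ≠ ∞ := hLp.2.2.eLpNorm_ne_top
  -- The optimal multiple of `μ₀` is the one of norm `1`.
  set a : ℝ≥0 := (lpNorm X p μ₀).toNNReal⁻¹ with ha
  have hac : (a : ℝ≥0∞) = (lpNorm X p μ₀)⁻¹ := by
    rw [ha, ENNReal.coe_inv (by simp [ENNReal.toNNReal_eq_zero_iff, hc0, hct]),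
      ENNReal.coe_toNNReal hct]
  have hfeas : ConicFeasible k f X p (a • μ₀) := by
    refine ⟨hI.smul a, ?_, hLp.smul hX a⟩
    rw [lpNorm_smul hX, hac, ENNReal.inv_mul_cancel hc0 hct]
  have hmass : ∀ b : ℝ≥0, (b • μ₀).real X = b := fun b => by
    rw [real_eq_univ ((hLp.smul hX b).compl hX)]
    rw [Measure.real, Measure.smul_apply, measure_univ, ENNReal.smul_def, smul_eq_mul, mul_one,
      ENNReal.coe_toReal]
  have hall : ∀ ν, ConicFeasible k f X p ν → ∃ b : ℝ≥0, b ≤ a ∧ ν = b • μ₀ := fun ν hν => by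
    have hν' := eq_smul_of_invariant hX huniq hν.2.2 hν.1
    refine ⟨_, ?_, hν'⟩
    have h₁ := hν.2.1
    rw [hν', lpNorm_smul hX] at h₁
    rw [← ENNReal.coe_le_coe, hac]
    exact ENNReal.le_inv_iff_mul_le.2 h₁
  refine ⟨a • μ₀, ⟨hfeas, fun ν hν => ?_⟩, fun ν hν => ?_⟩
  · obtain ⟨b, hb, rfl⟩ := hall ν hν
    rw [hmass, hmass]
    exact_mod_cast hb
  · obtain ⟨b, hb, rfl⟩ := hall ν hν.1
    have := hν.2 _ hfeas
    rw [hmass, hmass] at this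
    rw [le_antisymm hb (by exact_mod_cast this)]

/-! ### Convergence of the hierarchy -/

theorem PsdConstraints.mono {g : Fin m → MvPolynomial (Fin n) ℝ} {p : ℝ≥0∞} {r s : ℕ}
    {y : (Fin n →₀ ℕ) → ℝ} (hy : PsdConstraints g p r y) (hs : s ≤ r) :
    PsdConstraints g p s y := by
  rw [psdConstraints_iff] at hy ⊢
  exact ⟨fun hp q hq => hy.1 hp q (hq.trans hs), fun hp q hq => hy.2.1 hp q (hq.trans hs),
    fun q hq => hy.2.2.1 q (hq.trans hs),
    fun j q hq => hy.2.2.2 j q (hq.trans (Nat.sub_le_sub_right hs _))⟩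

/-- Along every ultrafilter, optimal solutions converge to a sequence satisfying the constraints
of all orders, hence to the moments of a feasible measure, whose mass is at least the optimal
value. By uniqueness, the limit does not depend on the ultrafilter. -/
theorem tendsto_sdpOptimal {k : TimeKind} {f : Fin n → MvPolynomial (Fin n) ℝ}
    {g : Fin m → MvPolynomial (Fin n) ℝ} (hg : Archimedean g) {p : ℝ≥0∞} (hp : p = 2 ∨ p = ∞)
    {μ : Measure (Fin n → ℝ)} (hμ : ConicOptimal k f (semialgSet g) p μ)
    (huniq : ∀ ν, ConicOptimal k f (semialgSet g) p ν → ν = μ)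
    {y : (r : ℕ) → Expo n (sdpDegree f r) → ℝ}
    (hy : ∀ r, rMin g ≤ r → SdpOptimal k f g p r (y r)) (α : Fin n →₀ ℕ) :
    Tendsto (fun r => zeroExt (y r) α) atTop (𝓝 (moment μ α)) := by
  have hX := isCompact_semialgSet hg
  obtain ⟨j, N, hj⟩ := id hg
  rw [tendsto_iff_ultrafilter]
  intro U hU
  have hlim : ∀ α, ∃ c, Tendsto (fun r => zeroExt (y r) α) U (𝓝 c) := by
    intro α
    have hev : ∀ᶠ r in (U : Filter ℕ), zeroExt (y r) α ∈
        Set.Icc (-momentBound (semialgSet g) N α) (momentBound (semialgSet g) N α) := by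
      filter_upwards [hU (eventually_ge_atTop (max (rMin g) α.degree))] with r hr
      exact _root_.abs_le.1 (PsdConstraints.abs_le hp
        (hy r ((le_max_left _ _).trans hr)).1.2 hj
        (((le_max_right _ _).trans hr).trans (by omega)))
    obtain ⟨c, -, hc⟩ := isCompact_Icc.ultrafilter_le_nhds (U.map fun r => zeroExt (y r) α)
      (le_principal_iff.2 hev)
    exact ⟨c, hc⟩
  choose w hw using hlim
  have hw' : Tendsto (fun r => zeroExt (y r)) U (𝓝 w) := tendsto_pi_nhds.2 hw
  have hpsd : ∀ s, rMin g ≤ s → PsdConstraints g p s w := fun s hs =>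
    (isClosed_psdConstraints g p s).mem_of_tendsto hw' (by
      filter_upwards [hU (eventually_ge_atTop s)] with r hr
      exact PsdConstraints.mono (hy r (hs.trans hr)).1.2 hr)
  have hzero : ∀ β, riesz w (invOp k f (MvPolynomial.monomial β 1)) = 0 := fun β => by
    have h₁ := ((continuous_riesz (invOp k f (MvPolynomial.monomial β 1))).tendsto w).comp hw'
    refine tendsto_nhds_unique h₁ (tendsto_const_nhds.congr' ?_)
    filter_upwards [hU (eventually_ge_atTop (max (rMin g) β.degree))] with r hr
    have := (hy r ((le_max_left _ _).trans hr)).1.1 β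
      (((le_max_right _ _).trans hr).trans (by omega))
    rw [invFunctional_eq_riesz] at this
    exact this.symm
  obtain ⟨ν, hν, rfl⟩ := exists_conicFeasible_of_psdConstraints hg hp hpsd hzero
  have hge : moment μ 0 ≤ moment ν 0 := by
    refine ge_of_tendsto (hw 0) ?_
    filter_upwards [hU (eventually_ge_atTop (rMin g))] with r hr
    have := (hy r hr).2 _ (hμ.1.sdpFeasible hg hr)
    rwa [zeroExt_of_le _ (by simp)] at this
  have hmass : ∀ κ, ConicFeasible k f (semialgSet g) p κ → κ.real (semialgSet g) = moment κ 0 :=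
    fun κ hκ => by rw [moment_zero, real_eq_univ (hκ.2.2.compl hX)]
  have hνopt : ConicOptimal k f (semialgSet g) p ν := ⟨hν, fun κ hκ => by
    refine (hμ.2 κ hκ).trans ?_
    rwa [hmass μ hμ.1, hmass ν hν]⟩
  rw [← huniq ν hνopt]
  exact hw α

theorem conicValue_eq {k : TimeKind} {f : Fin n → MvPolynomial (Fin n) ℝ}
    {X : Set (Fin n → ℝ)} {p : ℝ≥0∞} {μ : Measure (Fin n → ℝ)} (hμ : ConicOptimal k f X p μ) :
    conicValue k f X p = μ.real X :=
  IsGreatest.csSup_eq ⟨⟨μ, hμ.1, rfl⟩, by rintro t ⟨ν, hν, rfl⟩; exact hμ.2 ν hν⟩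

theorem sdpValue_eq {k : TimeKind} {f : Fin n → MvPolynomial (Fin n) ℝ}
    {g : Fin m → MvPolynomial (Fin n) ℝ} {p : ℝ≥0∞} {r : ℕ} {y : Expo n (sdpDegree f r) → ℝ}
    (hy : SdpOptimal k f g p r y) : sdpValue k f g p r = zeroExt y 0 :=
  IsGreatest.csSup_eq ⟨⟨y, hy.1, rfl⟩, by rintro t ⟨w, hw, rfl⟩; exact hy.2 w hw⟩

end

end InvMeas

theorem mainTheorem2 {n m : ℕ} (k : InvMeas.TimeKind)
    (f : Fin n → MvPolynomial (Fin n) ℝ) (g : Fin m → MvPolynomial (Fin n) ℝ)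
    (hg : InvMeas.Archimedean g) (p : ℝ≥0∞) (hp : p = 2 ∨ p = ∞)
    (hinv : InvMeas.UniqueInvariantDensity k f (InvMeas.semialgSet g) p) :
    ∃ μ : Measure (Fin n → ℝ),
      InvMeas.ConicOptimal k f (InvMeas.semialgSet g) p μ ∧
      (∀ ν, InvMeas.ConicOptimal k f (InvMeas.semialgSet g) p ν → ν = μ) ∧
      (∀ r, InvMeas.rMin g ≤ r → ∃ y, InvMeas.SdpOptimal k f g p r y) ∧
      (∀ y : (r : ℕ) → InvMeas.Expo n (InvMeas.sdpDegree f r) → ℝ,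
        (∀ r, InvMeas.rMin g ≤ r → InvMeas.SdpOptimal k f g p r (y r)) →
        ∃ yStar : (Fin n →₀ ℕ) → ℝ,
          (∀ α, Tendsto (fun r => InvMeas.zeroExt (y r) α) atTop (𝓝 (yStar α))) ∧
          InvMeas.Represents (InvMeas.semialgSet g) yStar μ) ∧
      Tendsto (fun r => InvMeas.sdpValue k f g p r) atTop
        (𝓝 (InvMeas.conicValue k f (InvMeas.semialgSet g) p)) ∧
      ENNReal.ofReal (InvMeas.conicValue k f (InvMeas.semialgSet g) p) =
        InvMeas.lpNorm (InvMeas.semialgSet g) 1 μ := by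
  have hX := InvMeas.isCompact_semialgSet hg
  have hp0 : p ≠ 0 := by rcases hp with rfl | rfl <;> norm_num
  obtain ⟨μ, hμ, huniq⟩ := InvMeas.exists_unique_conicOptimal hX hp0 hinv
  have hfin : IsFiniteMeasure μ := hμ.1.2.2.1
  have hμX := hμ.1.2.2.compl hX
  have hex : ∀ r, InvMeas.rMin g ≤ r → ∃ y, InvMeas.SdpOptimal k f g p r y := fun r hr =>
    InvMeas.exists_sdpOptimal hg hp hr ⟨_, hμ.1.sdpFeasible hg hr⟩
  refine ⟨μ, hμ, huniq, hex, fun y hy => ⟨InvMeas.moment μ,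
    InvMeas.tendsto_sdpOptimal hg hp hμ huniq hy, hfin, hμX, fun _ => rfl⟩, ?_, ?_⟩
  · have hex' : ∀ r, ∃ y, InvMeas.rMin g ≤ r → InvMeas.SdpOptimal k f g p r y := fun r => by
      by_cases hr : InvMeas.rMin g ≤ r
      · obtain ⟨y, hy⟩ := hex r hr
        exact ⟨y, fun _ => hy⟩
      · exact ⟨0, fun h => absurd h hr⟩
    choose y hy using hex'
    rw [InvMeas.conicValue_eq hμ, InvMeas.real_eq_univ hμX, ← InvMeas.moment_zero]
    refine (InvMeas.tendsto_sdpOptimal hg hp hμ huniq hy 0).congr' ?_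
    filter_upwards [eventually_ge_atTop (InvMeas.rMin g)] with r hr
    rw [InvMeas.sdpValue_eq (hy r hr)]
  · rw [InvMeas.conicValue_eq hμ, InvMeas.real_eq_univ hμX, InvMeas.lpNorm_one_eq hX hμ.1.2.2,
      ofReal_measureReal]
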